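/- Let $\mathfrak{M}$ be the class of all matroids whose ground set is a finite set of positive integers. For a finite set $E$ of positive integers let $\mathfrak{M}_E\subseteq\mathfrak{M}$ be the set of matroids with ground set $E$, and for $\mathsf{M}\in\mathfrak{M}_E$ let $\mathscr{P}(\mathsf{M})\subseteq\mathbb{R}^E$ be its base polytope, i.e. the convex hull of the vectors $e_B=\sum_{i\in B}e_i$, $B$ a basis of $\mathsf{M}$. Let $\mathbb{I}_{\mathfrak{M}_E}$ be the group of functions $\mathbb{R}^E\to\mathbb{Z}$ generated by the indicator functions $\mathbb{1}_{\mathscr{P}(\mathsf{M})}$, $\mathsf{M}\in\mathfrak{M}_E$. A map $f$ from $\mathfrak{M}$ to an abelian group $\mathrm{A}$ is a *valuation* if for every $E$ there is a group homomorphism $\widehat f:\mathbb{I}_{\mathfrak{M}_E}\to \mathrm{A}$ with $f(\mathsf{M})=\widehat f(\mathbb{1}_{\mathscr{P}(\mathsf{M})})$ for all $\mathsf{M}\in\mathfrak{M}_E$; it is an *invariant* if $f(\mathsf{M})=f(\mathsf{N})$ whenever $\mathsf{M}\cong\mathsf{N}$ (on possibly different ground sets); and it is a *valuative invariant* if it is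 both. For a loopless matroid $\mathsf{M}$ on $E$, let $\widehat{\mathcal{L}}(\mathsf{M})$ be the set of flats of $\mathsf{M}$ other than $\varnothing$ and $E$. The Chow ring of $\mathsf{M}$ is the graded ring $$\mathrm{A}(\mathsf{M})=\mathbb{Q}[x_F : F\in\widehat{\mathcal{L}}(\mathsf{M})]/(I+J),$$ where $I$ is generated by the products $x_{F_1}x_{F_2}$ with $F_1,F_2\in\widehat{\mathcal{L}}(\mathsf{M})$ incomparable, $J$ is generated by the elements $\sum_{F\ni i}x_F-\sum_{F\ni j}x_F$ with $i,j\in E$, and each $x_F$ has degree $1$. Its Hilbert–Poincaré series is $\operatorname{Hilb}(\mathrm{A}(\mathsf{M}),x)=\sum_{j\ge 0}\dim_{\mathbb{Q}}(\mathrm{A}^j(\mathsf{M}))\,x^j$. **Theorem 8.10.** For every loopless $\mathsf{M}\in\mathfrak{M}$ the series $\operatorname{Hilb}(\mathrm{A}(\mathsf{M}),x)$ is a polynomial, and the map $\mathfrak{M}\to\mathbb{Z}[x]$ that assigns $\operatorname{Hilb}(\mathrm{A}(\mathsf{M}),x)$ to each loopless matroid $\mathsf{M}$ and the zero polynomial to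 each matroid with loops is a valuative invariant. -/

import Mathlib

namespace ChowValuation

/-- The class `𝔐` of all matroids whose ground set is a finite set of positive integers. -/
abbrev FinMatroid : Type := {M : Matroid ℕ+ // M.E.Finite}

/-- Two matroids are isomorphic if some bijection of their ground sets matches their bases. -/
def Isomorphic (M N : FinMatroid) : Prop :=
  ∃ φ : M.1.E ≃ N.1.E, ∀ B : Set M.1.E,
    N.1.IsBase (Subtype.val '' (φ '' B)) ↔ M.1.IsBase (Subtype.val '' B)

/-- A map on `𝔐` is an invariant if it is constant on isomorphism classes. -/
def IsInvariant {A : Type*} (f : FinMatroid → A) : Prop :=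
  ∀ M N : FinMatroid, Isomorphic M N → f M = f N

/-! ### Base polytopes and valuations -/

/-- The base polytope, in `ℝ^E`, of a matroid with ground set `E`:
the convex hull of the vectors `e_B` for the bases `B`. -/
def basePolytope (E : Finset ℕ+) (M : Matroid ℕ+) : Set (E → ℝ) :=
  convexHull ℝ {v | ∃ B : Set ℕ+, M.IsBase B ∧ v = fun i : E => B.indicator (fun _ => (1 : ℝ)) (i : ℕ+)}

/-- The family `𝔐_E` of base polytopes of the matroids with ground set `E`. -/
def matroidPolytopes (E : Finset ℕ+) : Set (Set (E → ℝ)) :=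
  {P | ∃ M : FinMatroid, M.1.E = ↑E ∧ P = basePolytope E M.1}

/-- The indicator function `ℝ^E → ℤ` of a subset of `ℝ^E`. -/
noncomputable def polytopeIndicator {ι : Type*} (P : Set (ι → ℝ)) : (ι → ℝ) → ℤ :=
  P.indicator 1

/-- The indicator subgroup of a family of polytopes: the integer combinations of the
indicator functions of its members. -/
def indicatorSubgroup {ι : Type*} (𝔓 : Set (Set (ι → ℝ))) : AddSubgroup ((ι → ℝ) → ℤ) :=
  AddSubgroup.closure (polytopeIndicator '' 𝔓)

/-- The indicator function of a member of the family, as an element of the indicator subgroup. -/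
noncomputable def indicatorOf {ι : Type*} (𝔓 : Set (Set (ι → ℝ))) (P : 𝔓) :
    indicatorSubgroup 𝔓 :=
  ⟨polytopeIndicator P.1, AddSubgroup.subset_closure (Set.mem_image_of_mem _ P.2)⟩

/-- A map `f : 𝔐 → A` to an abelian group is a (strong) valuation if, for every finite ground
set `E`, its restriction to the matroids on `E` factors through indicator functions of base
polytopes by a homomorphism from the indicator subgroup of `𝔐_E` to `A`. -/
def IsValuation {A : Type*} [AddCommGroup A] (f : FinMatroid → A) : Prop :=
  ∀ E : Finset ℕ+, ∃ fhat : indicatorSubgroup (matroidPolytopes E) →+ A,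
    ∀ (M : FinMatroid) (hM : M.1.E = ↑E),
      f M = fhat (indicatorOf (matroidPolytopes E) ⟨basePolytope E M.1, M, hM, rfl⟩)

/-- A valuative invariant is an invariant that is also a valuation. -/
def IsValuativeInvariant {A : Type*} [AddCommGroup A] (f : FinMatroid → A) : Prop :=
  IsInvariant f ∧ IsValuation f

/-! ### Chow rings and their Hilbert-Poincaré series -/

/-- The proper flats of a matroid: the flats other than `∅` and the ground set. -/
abbrev ProperFlat (M : FinMatroid) : Type :=
  {F : Set ℕ+ // M.1.IsFlat F ∧ F ≠ ∅ ∧ F ≠ M.1.E}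

instance properFlat_finite (M : FinMatroid) : Finite (ProperFlat M) :=
  (M.2.finite_subsets.subset fun _ hF => hF.1.subset_ground :
    {F : Set ℕ+ | M.1.IsFlat F ∧ F ≠ ∅ ∧ F ≠ M.1.E}.Finite).to_subtype

noncomputable instance properFlat_fintype (M : FinMatroid) : Fintype (ProperFlat M) :=
  Fintype.ofFinite _

open Classical in
/-- The linear form `∑_{F ∋ i} x_F`, the sum running over the proper flats containing `i`. -/
noncomputable def flatSum (M : FinMatroid) (i : ℕ+) : MvPolynomial (ProperFlat M) ℚ :=
  ∑ F : ProperFlat M with i ∈ F.1, MvPolynomial.X F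

/-- The ideal `I` generated by the products `x_{F₁} x_{F₂}` with `F₁`, `F₂` incomparable. -/
noncomputable def incomparableIdeal (M : FinMatroid) : Ideal (MvPolynomial (ProperFlat M) ℚ) :=
  Ideal.span {p | ∃ F₁ F₂ : ProperFlat M, ¬ F₁.1 ⊆ F₂.1 ∧ ¬ F₂.1 ⊆ F₁.1 ∧
    p = MvPolynomial.X F₁ * MvPolynomial.X F₂}

/-- The ideal `J` generated by the differences `∑_{F ∋ i} x_F - ∑_{F ∋ j} x_F`, `i, j ∈ E`. -/
noncomputable def linearIdeal (M : FinMatroid) : Ideal (MvPolynomial (ProperFlat M) ℚ) :=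
  Ideal.span {p | ∃ i ∈ M.1.E, ∃ j ∈ M.1.E, p = flatSum M i - flatSum M j}

/-- The Chow ring `A(M) = ℚ[x_F : F a proper flat] / (I + J)`. -/
abbrev ChowRing (M : FinMatroid) : Type :=
  MvPolynomial (ProperFlat M) ℚ ⧸ (incomparableIdeal M ⊔ linearIdeal M)

/-- The graded piece `A^j(M)`: the classes of the homogeneous polynomials of degree `j`. -/
noncomputable def chowGraded (M : FinMatroid) (j : ℕ) : Submodule ℚ (ChowRing M) :=
  (MvPolynomial.homogeneousSubmodule (ProperFlat M) ℚ j).map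
    (Ideal.Quotient.mkₐ ℚ (incomparableIdeal M ⊔ linearIdeal M)).toLinearMap

/-- The Hilbert-Poincaré series `∑_j dim_ℚ A^j(M) x^j` of the Chow ring. -/
noncomputable def hilbertSeries (M : FinMatroid) : PowerSeries ℤ :=
  PowerSeries.mk fun j => (Module.finrank ℚ (chowGraded M j) : ℤ)

end ChowValuation

/-!
# The Hilbert series of the Chow ring is a valuative invariant

**A monomial basis of the Chow ring.** For a loopless matroid put `h_A = ∑_{F ⊇ A} x_F`, summed over
all nonempty flats, where `x_E` stands for `-∑_{F ∋ i} x_F` (the same class for every `i`). These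
elements vanish for singletons, depend only on the closure of `A`, generate the ring, and satisfy
`(h_A - h_{A ∪ B}) (h_B - h_{A ∪ B}) = 0` (`nef_sub_mul_nef_sub`). The last relation straightens a
product over incomparable flats; with `h_{i} = 0` it also gives `h_F h_G ^ s = h_G ^ (s + 1)` for
flats `F ⊆ G` whose ranks differ by `s`, and `h_G ^ (rk G) = 0`. These rewritings raise the total
rank of a monomial or annihilate it, so the ring is spanned by the *normal* monomials
`∏ h_{F_i} ^ {d_i}` over chains of nonempty flats with `d_i < rk F_i - rk F_{i-1}`
(`chowGraded_eq_span`).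

For linear independence, each normal exponent `d` defines a functional that takes the value `0` or
`1` on every monomial in the `h_F`: the factors have to be distributed over the intervals of the
chain of `d` as those of `d` are, and to satisfy the dragon marriage condition in each interval,
i.e. any subfamily has relative rank larger than its cardinality. This functional respects the
relations between the `h_F` (`matchCoeff_quadratic`), which comes down to submodularity of the rank
function (`not_dragon_join`), and the resulting pairing of normal exponents is triangular with
nonzero diagonal (`isMatched_self`, `IsMatched.eq_or_rankWeight_lt`).

So the Hilbert series is the generating polynomial of the normal exponents (`countingPolynomial`).
It is a polynomial and clearly an isomorphism invariant.

**Valuativity.** Whether an exponent is normal depends only on the ranks of the members of a chain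
and on whether they are flats. It therefore suffices that, for a chain `C` and a function `r`, the
property "loopless, and every `F ∈ C` is a flat of rank `r F`" is a valuation
(`exists_hom_rank_data`). The Euler characteristic shows that `P ↦ [P ∩ Q ≠ ∅]` is a valuation for
every closed convex `Q` (`exists_hom_meets`), and the property above is the difference of two of
these: all points of the base polytope have `∑_{e ∈ F} x_e ≤ rk F`, the members of a chain attain
their bounds simultaneously, and when they are attained, a point with positive coordinates exists
exactly if the matroid is loopless and the members of the chain are flats.
-/

namespace ChowValuation

open Set

/-! ### Integer-valued rank functions -/

section Rank

variable {α : Type*}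

/-- The rank of a set in a matroid of finite rank, as a natural number. -/
noncomputable def rk (M : Matroid α) (A : Set α) : ℕ := (M.eRk A).toNat

variable (M : Matroid α) [M.RankFinite] {A B F G : Set α}

lemma coe_rk (A : Set α) : (rk M A : ℕ∞) = M.eRk A :=
  ENat.natCast_toNat (Matroid.eRk_ne_top_iff.2 (M.isRkFinite_set A))

lemma rk_mono (h : A ⊆ B) : rk M A ≤ rk M B := by
  have := M.eRk_mono h
  rw [← coe_rk, ← coe_rk] at this
  exact_mod_cast this

lemma rk_inter_add_rk_union_le (A B : Set α) :
    rk M (A ∩ B) + rk M (A ∪ B) ≤ rk M A + rk M B := by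
  have := M.eRk_inter_add_eRk_union_le A B
  simp only [← coe_rk] at this
  exact_mod_cast this

omit [M.RankFinite] in
@[simp] lemma rk_empty : rk M ∅ = 0 := by simp [rk]

omit [M.RankFinite] in
lemma rk_closure (A : Set α) : rk M (M.closure A) = rk M A := by simp [rk]

/-- The rank of a set does not change on adding elements of its closure. -/
lemma rk_eq_of_subset_closure (h : A ⊆ B) (h' : B ⊆ M.closure A) : rk M B = rk M A :=
  le_antisymm ((rk_mono M h').trans (rk_closure M A).le) (rk_mono M h)

lemma rk_insert_le (e : α) (A : Set α) : rk M (insert e A) ≤ rk M A + 1 := by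
  have := M.eRk_insert_le_add_one e A
  simp only [← coe_rk] at this
  exact_mod_cast this

omit [M.RankFinite] in
lemma rk_eq_ncard {I : Set α} (h : M.IsBasis I A) : rk M A = I.ncard := by
  rw [rk, ← h.encard_eq_eRk, ncard_def]

lemma ncard_le_rk {I : Set α} (h : M.Indep I) (hI : I ⊆ A) : I.ncard ≤ rk M A := by
  have := h.encard_le_eRk_of_subset hI
  rw [← coe_rk, ← h.finite.cast_ncard_eq] at this
  exact_mod_cast this

lemma rk_insert_of_notMem_closure {e : α} (he : e ∈ M.E) (h : e ∉ M.closure A) :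
    rk M (insert e A) = rk M A + 1 := by
  have := Matroid.eRk_insert_eq_add_one (M := M) ⟨he, h⟩
  simp only [← coe_rk] at this
  exact_mod_cast this

lemma rk_lt_of_ssubset (hF : M.IsFlat F) (hB : B ⊆ M.E) (h : F ⊂ B) : rk M F < rk M B := by
  obtain ⟨e, heB, heF⟩ := exists_of_ssubset h
  have h1 := rk_insert_of_notMem_closure M (A := F) (hB heB) (by rwa [hF.closure])
  have h2 := rk_mono M (insert_subset heB h.subset)
  omega

lemma rk_pos (hL : M.Loopless) (hA : A ⊆ M.E) (hne : A.Nonempty) : 0 < rk M A := by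
  have h : M.IsFlat ∅ := by
    rw [Matroid.isFlat_iff_closure_eq, Matroid.closure_empty, hL.loops_eq_empty]
  simpa using rk_lt_of_ssubset M h hA hne.empty_ssubset

lemma rk_le_ncard (hA : A.Finite) : rk M A ≤ A.ncard := by
  have := M.eRk_le_encard A
  rw [← coe_rk, ← hA.cast_ncard_eq] at this
  exact_mod_cast this

omit [M.RankFinite] in
lemma rk_congr (h : M.closure A = M.closure B) : rk M A = rk M B := by
  rw [← rk_closure M A, h, rk_closure]

/-- A flat `F` contained in a flat `G` is completed to a spanning set of `G` by
`rk G - rk F` elements. -/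
lemma exists_finset_closure_union_eq (hF : M.IsFlat F) (hG : M.IsFlat G) (h : F ⊆ G) :
    ∃ T : Finset α, (T : Set α) ⊆ M.E ∧ T.card = rk M G - rk M F ∧
      M.closure (F ∪ T) = G := by
  obtain ⟨I, hI⟩ := M.exists_isBasis F hF.subset_ground
  obtain ⟨J, hJ, hIJ⟩ := hI.indep.subset_isBasis_of_subset (hI.subset.trans h) hG.subset_ground
  have hfin : (J \ I).Finite := hJ.indep.finite.subset sdiff_subset
  refine ⟨hfin.toFinset, ?_, ?_, ?_⟩
  · rw [hfin.coe_toFinset]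
    exact sdiff_subset.trans hJ.indep.subset_ground
  · rw [← ncard_eq_toFinset_card _ hfin, ncard_sdiff hIJ hI.indep.finite, rk_eq_ncard M hI,
      rk_eq_ncard M hJ]
  · rw [hfin.coe_toFinset]
    apply subset_antisymm
    · rw [← hG.closure]
      exact M.closure_subset_closure (union_subset h (sdiff_subset.trans hJ.subset))
    · rw [← hG.closure, ← hJ.closure_eq_closure]
      apply M.closure_subset_closure
      intro e he
      by_cases heI : e ∈ I
      · exact Or.inl (hI.subset heI)
      · exact Or.inr ⟨he, heI⟩

end Rank

/-! ### Bases adapted to a chain -/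

section Adapted

variable {α : Type*} (M : Matroid α)

/-- Some independent set meets every member of a finite chain of sets in a basis. -/
lemma exists_indep_adapted (hE : M.E.Finite) (C : Finset (Set α)) (hCE : ∀ F ∈ C, F ⊆ M.E)
    (hC : ∀ F ∈ C, ∀ G ∈ C, F ⊆ G ∨ G ⊆ F) :
    ∃ I, M.Indep I ∧ (∀ X, (∀ F ∈ C, F ⊆ X) → I ⊆ X) ∧ ∀ F ∈ C, M.IsBasis (F ∩ I) F := by
  classical
  induction C using Finset.induction_on_max_value (f := Set.ncard) with
  | empty => exact ⟨∅, M.empty_indep, by simp, by simp⟩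
  | insert A C hA hmax ih =>
    obtain ⟨I, hI, hIX, hIC⟩ := ih (fun F hF => hCE F (by simp [hF]))
      (fun F hF G hG => hC F (by simp [hF]) G (by simp [hG]))
    have hsub : ∀ F ∈ C, F ⊆ A := by
      intro F hF
      rcases hC F (by simp [hF]) A (by simp) with h | h
      · exact h
      · exact (eq_of_subset_of_ncard_le h (hmax F hF)
          (hE.subset (hCE F (by simp [hF])))).symm.subset
    obtain ⟨J, hJ, hIJ⟩ := hI.subset_isBasis_of_subset (hIX A hsub) (hCE A (by simp))
    refine ⟨J, hJ.indep, fun X hX => hJ.subset.trans (hX A (by simp)), ?_⟩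
    intro F hF
    rcases Finset.mem_insert.1 hF with rfl | hF
    · rwa [inter_eq_self_of_subset_right hJ.subset]
    · have h := (hIC F hF).eq_of_subset_indep (hJ.indep.inter_left F)
        (inter_subset_inter_right F hIJ) inter_subset_left
      rw [← h]
      exact hIC F hF

/-- Some base meets every member of a finite chain of sets in a basis. -/
lemma exists_isBase_adapted (hE : M.E.Finite) (C : Finset (Set α)) (hCE : ∀ F ∈ C, F ⊆ M.E)
    (hC : ∀ F ∈ C, ∀ G ∈ C, F ⊆ G ∨ G ⊆ F) :
    ∃ B, M.IsBase B ∧ ∀ F ∈ C, (F ∩ B).ncard = rk M F := by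
  obtain ⟨I, hI, -, hIC⟩ := exists_indep_adapted M hE C hCE hC
  obtain ⟨B, hB, hIB⟩ := hI.exists_isBase_superset
  refine ⟨B, hB, fun F hF => ?_⟩
  have h := (hIC F hF).eq_of_subset_indep (hB.indep.inter_left F)
    (inter_subset_inter_right F hIB) inter_subset_left
  rw [← h, rk_eq_ncard M (hIC F hF)]

variable [M.RankFinite]

/-- In a loopless matroid, a base adapted to a chain of flats can be chosen to contain any given
element `e`: the chain is enlarged by `F ∪ {e}`, where `F` is its largest member without `e`. -/
lemma exists_isBase_adapted_mem (hL : M.Loopless) (hE : M.E.Finite) (C : Finset (Set α))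
    (hCF : ∀ F ∈ C, M.IsFlat F) (hC : ∀ F ∈ C, ∀ G ∈ C, F ⊆ G ∨ G ⊆ F) {e : α} (he : e ∈ M.E) :
    ∃ B, M.IsBase B ∧ e ∈ B ∧ ∀ F ∈ C, (F ∩ B).ncard = rk M F := by
  classical
  obtain ⟨F₀, hF₀, hF₀e, hF₀C, hF₀max⟩ : ∃ F₀, M.IsFlat F₀ ∧ e ∉ F₀ ∧
      (∀ F ∈ C, F ⊆ F₀ ∨ F₀ ⊆ F) ∧ ∀ F ∈ C, e ∉ F → F ⊆ F₀ := by
    by_cases hne : (C.filter (e ∉ ·)).Nonempty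
    · obtain ⟨F, hF, hmax⟩ := Finset.exists_max_image (C.filter (e ∉ ·)) Set.ncard hne
      rw [Finset.mem_filter] at hF
      refine ⟨F, hCF F hF.1, hF.2, fun G hG => hC G hG F hF.1, fun G hG heG => ?_⟩
      rcases hC G hG F hF.1 with h | h
      · exact h
      · exact (eq_of_subset_of_ncard_le h (hmax G (by simp [hG, heG]))
          (hE.subset (hCF G hG).subset_ground)).symm.subset
    · rw [Finset.not_nonempty_iff_eq_empty, Finset.filter_eq_empty_iff] at hne
      refine ⟨∅, ?_, by simp, by simp, fun F hF h => absurd h (hne hF)⟩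
      rw [Matroid.isFlat_iff_closure_eq, Matroid.closure_empty, hL.loops_eq_empty]
  have hsub : ∀ F ∈ C, F ⊆ F₀ ∨ insert e F₀ ⊆ F := by
    intro F hF
    by_cases heF : e ∈ F
    · rcases hF₀C F hF with h | h
      · exact Or.inl h
      · exact Or.inr (insert_subset heF h)
    · exact Or.inl (hF₀max F hF heF)
  obtain ⟨B, hB, hBC⟩ := exists_isBase_adapted M hE (insert F₀ (insert (insert e F₀) C))
    (by
      simp only [Finset.mem_insert, forall_eq_or_imp]
      exact ⟨hF₀.subset_ground, insert_subset he hF₀.subset_ground,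
        fun F hF => (hCF F hF).subset_ground⟩)
    (by
      have h0 : F₀ ⊆ insert e F₀ := subset_insert _ _
      simp only [Finset.mem_insert, forall_eq_or_imp]
      refine ⟨⟨by simp, by simp, fun F hF => ?_⟩, ⟨by simp, by simp, fun F hF => ?_⟩,
        fun F hF => ⟨?_, ?_, fun G hG => hC F hF G hG⟩⟩
      all_goals
        rcases hsub F hF with h | h
        · simp [h, h.trans h0]
        · simp [h, h0.trans h])
  refine ⟨B, hB, ?_, fun F hF => hBC F (by simp [hF])⟩
  by_contra heB
  have h1 := hBC F₀ (by simp)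
  have h2 := hBC (insert e F₀) (by simp)
  rw [insert_inter_of_notMem heB, h1,
    rk_insert_of_notMem_closure M he (by rwa [hF₀.closure])] at h2
  omega

end Adapted

/-! ### The Euler characteristic of compact convex sets -/

section Euler

open Classical in
/-- The Euler relation on the line. Comparing the hypothesis at `t` and just to the right of `t`
shows that the coefficients of the intervals ending at `t` cancel. -/
lemma sum_eq_zero_of_sum_Icc_eq_zero {ι : Type*} (s : Finset ι) (a : ι → ℤ) (l u : ι → ℝ)
    (hlu : ∀ i ∈ s, l i ≤ u i) (h : ∀ t, ∑ i ∈ s with l i ≤ t ∧ t ≤ u i, a i = 0) :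
    ∑ i ∈ s, a i = 0 := by
  rw [← Finset.sum_fiberwise_of_maps_to (t := s.image u) (g := u)
    (fun i hi => Finset.mem_image_of_mem u hi)]
  refine Finset.sum_eq_zero fun t _ => ?_
  obtain ⟨t', ht', hs⟩ : ∃ t' > t, ∀ i ∈ s, (t < l i → t' < l i) ∧ (t < u i → t' < u i) := by
    have key : ∀ᶠ t' in nhdsWithin t (Ioi t),
        ∀ i ∈ s, (t < l i → t' < l i) ∧ (t < u i → t' < u i) := by
      rw [Filter.eventually_all_finset]
      intro i _
      have aux : ∀ v : ℝ, ∀ᶠ t' in nhdsWithin t (Ioi t), t < v → t' < v := by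
        intro v
        by_cases hv : t < v
        · exact ((eventually_lt_nhds hv).filter_mono nhdsWithin_le_nhds).mono fun _ h _ => h
        · exact Filter.Eventually.of_forall fun _ h => absurd h hv
      exact (aux _).and (aux _)
    obtain ⟨t', h1, h2⟩ := (key.and self_mem_nhdsWithin).exists
    exact ⟨t', h2, h1⟩
  have h1 := h t
  have h2 := h t'
  have e1 : ∑ i ∈ s with l i ≤ t ∧ t ≤ u i, a i =
      ∑ i ∈ s with l i ≤ t' ∧ t' ≤ u i, a i + ∑ i ∈ s with u i = t, a i := by
    simp only [Finset.sum_filter]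
    rw [← Finset.sum_add_distrib]
    refine Finset.sum_congr rfl fun i hi => ?_
    obtain ⟨hl, hu⟩ := hs i hi
    have hi' := hlu i hi
    rcases lt_trichotomy t (u i) with h3 | h3 | h3
    · have := hu h3
      by_cases h4 : t < l i
      · simp [h4.not_ge, (hl h4).not_ge, h3.ne']
      · simp [not_lt.1 h4, (not_lt.1 h4).trans ht'.le, h3.le, this.le, h3.ne']
    · have h4 : ¬ t' ≤ u i := by rw [← h3]; exact ht'.not_ge
      simp [h4, h3, hi']
    · have h4 : ¬ t' ≤ u i := (h3.trans ht').not_ge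
      simp [h4, h3.not_ge, h3.ne]
  rw [h1, h2, zero_add] at e1
  exact e1.symm

open Classical in
/-- A linear relation between indicator functions of compact convex sets whose points agree in
the coordinates outside `S` has coefficients of sum zero over the nonempty sets. The induction on
`S` slices along one coordinate. -/
lemma sum_nonempty_eq_zero_of_free_coords {E ι : Type*} (S : Finset E) :
    ∀ (s : Finset ι) (a : ι → ℤ) (K : ι → Set (E → ℝ)) (c : E → ℝ),
      (∀ i ∈ s, IsCompact (K i)) → (∀ i ∈ s, Convex ℝ (K i)) →
      (∀ i ∈ s, ∀ x ∈ K i, ∀ j ∉ S, x j = c j) →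
      (∀ x, ∑ i ∈ s with x ∈ K i, a i = 0) →
      ∑ i ∈ s with (K i).Nonempty, a i = 0 := by
  induction S using Finset.induction_on with
  | empty =>
    intro s a K c _ _ hc h
    rw [← h c]
    refine Finset.sum_congr (Finset.filter_congr fun i hi => ?_) fun _ _ => rfl
    refine ⟨fun ⟨x, hx⟩ => ?_, fun hx => ⟨c, hx⟩⟩
    rwa [← funext fun j => hc i hi x hx j (by simp)]
  | insert j S hj ih =>
    intro s a K c hK hconv hc h
    let l : ι → ℝ := fun i => sInf ((fun x : E → ℝ => x j) '' K i)
    let u : ι → ℝ := fun i => sSup ((fun x : E → ℝ => x j) '' K i)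
    have himg : ∀ i ∈ s, (K i).Nonempty → (fun x : E → ℝ => x j) '' K i = Icc (l i) (u i) := by
      intro i hi hne
      refine eq_Icc_of_connected_compact ?_ ((hK i hi).image (continuous_apply j))
      refine ⟨hne.image _, ?_⟩
      exact (hconv i hi).isPreconnected.image _ (continuous_apply j).continuousOn
    apply sum_eq_zero_of_sum_Icc_eq_zero _ a l u
    · intro i hi
      rw [Finset.mem_filter] at hi
      have := hi.2.image (fun x : E → ℝ => x j)
      rw [himg i hi.1 hi.2] at this
      exact nonempty_Icc.1 this
    · intro t
      have := ih s a (fun i => K i ∩ {x | x j = t}) (Function.update c j t)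
        (fun i hi => (hK i hi).inter_right (isClosed_eq (continuous_apply j) continuous_const))
        (fun i hi => (hconv i hi).inter 
          (convex_hyperplane (f := fun x : E → ℝ => x j) (LinearMap.proj j).isLinear t))
        (fun i hi x hx k hk => by
          rcases eq_or_ne k j with rfl | hkj
          · simpa using hx.2
          · rw [Function.update_of_ne hkj]
            exact hc i hi x hx.1 k (by simp [hkj, hk]))
        (fun x => by
          by_cases hx : x j = t
          · simpa [hx] using h x
          · simp [hx])
      rw [← this, Finset.filter_filter]
      refine Finset.sum_congr (Finset.filter_congr fun i hi => ?_) fun _ _ => rfl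
      constructor
      · rintro ⟨hne, ht⟩
        obtain ⟨x, hx, hxt⟩ : t ∈ (fun x : E → ℝ => x j) '' K i := by rwa [himg i hi hne]
        exact ⟨x, hx, hxt⟩
      · rintro ⟨x, hx, hxt⟩
        refine ⟨⟨x, hx⟩, ?_⟩
        have : t ∈ (fun x : E → ℝ => x j) '' K i := ⟨x, hx, hxt⟩
        rwa [himg i hi ⟨x, hx⟩] at this

open Classical in
/-- The Euler characteristic: a linear relation between indicator functions of compact convex
sets has coefficients of sum zero over the nonempty sets. -/
lemma sum_nonempty_eq_zero {E ι : Type*} [Fintype E] (s : Finset ι) (a : ι → ℤ)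
    (K : ι → Set (E → ℝ)) (hK : ∀ i ∈ s, IsCompact (K i)) (hconv : ∀ i ∈ s, Convex ℝ (K i))
    (h : ∀ x, ∑ i ∈ s with x ∈ K i, a i = 0) :
    ∑ i ∈ s with (K i).Nonempty, a i = 0 :=
  sum_nonempty_eq_zero_of_free_coords Finset.univ s a K 0 hK hconv (by simp) h

/-- A function on a generating family of a group extends to a homomorphism on the indicator
subgroup as soon as it respects all linear relations between the indicator functions. -/
lemma exists_hom_of_relations {ι A : Type*} [AddCommGroup A] (𝔓 : Set (Set (ι → ℝ))) (v : 𝔓 → A)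
    (hv : ∀ c : 𝔓 →₀ ℤ, (∀ x, c.sum (fun P k => k * polytopeIndicator P.1 x) = 0) →
      c.sum (fun P k => k • v P) = 0) :
    ∃ χ : indicatorSubgroup 𝔓 →+ A, ∀ P, χ (indicatorOf 𝔓 P) = v P := by
  let T : (𝔓 →₀ ℤ) →+ indicatorSubgroup 𝔓 :=
    (Finsupp.linearCombination ℤ (indicatorOf 𝔓)).toAddMonoidHom
  let V : (𝔓 →₀ ℤ) →+ A := (Finsupp.linearCombination ℤ v).toAddMonoidHom
  have hT : Function.Surjective T := by
    rintro ⟨g, hg⟩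
    refine AddSubgroup.closure_induction
      (p := fun g hg => ∃ c, T c = (⟨g, hg⟩ : indicatorSubgroup 𝔓)) ?_ ?_ ?_ ?_ hg
    · rintro _ ⟨P, hP, rfl⟩
      exact ⟨Finsupp.single ⟨P, hP⟩ 1, by simp [T, indicatorOf]⟩
    · exact ⟨0, map_zero T⟩
    · rintro x y hx hy ⟨c, hc⟩ ⟨d, hd⟩
      exact ⟨c + d, by rw [map_add, hc, hd]; rfl⟩
    · rintro x hx ⟨c, hc⟩
      exact ⟨-c, by rw [map_neg, hc]; rfl⟩
  have hker : T.ker ≤ V.ker := by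
    intro c hc
    rw [AddMonoidHom.mem_ker] at hc ⊢
    refine hv c fun x => ?_
    have := congrArg (fun g : indicatorSubgroup 𝔓 => (g : (ι → ℝ) → ℤ) x) hc
    simpa [T, Finsupp.linearCombination_apply, Finsupp.sum, indicatorOf] using this
  refine ⟨T.liftOfSurjective hT ⟨V, hker⟩, fun P => ?_⟩
  have h := T.liftOfRightInverse_comp_apply _ (Function.rightInverse_surjInv hT) ⟨V, hker⟩
    (Finsupp.single P 1)
  have e : T (Finsupp.single P 1) = indicatorOf 𝔓 P := by simp [T]
  rw [e] at h
  refine h.trans ?_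
  simp [V]

open Classical in
/-- Whether a polytope meets a fixed closed convex set is a valuation. -/
lemma exists_hom_meets {ι : Type*} [Fintype ι] (𝔓 : Set (Set (ι → ℝ)))
    (hP : ∀ P ∈ 𝔓, IsCompact P ∧ Convex ℝ P) {Q : Set (ι → ℝ)} (hQ : IsClosed Q)
    (hQ' : Convex ℝ Q) :
    ∃ χ : indicatorSubgroup 𝔓 →+ ℤ,
      ∀ P, χ (indicatorOf 𝔓 P) = if (P.1 ∩ Q).Nonempty then 1 else 0 := by
  refine exists_hom_of_relations 𝔓 (fun P => if (P.1 ∩ Q).Nonempty then 1 else 0) fun c hc => ?_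
  have := sum_nonempty_eq_zero c.support c (fun P => P.1 ∩ Q)
    (fun P _ => (hP P.1 P.2).1.inter_right hQ) (fun P _ => (hP P.1 P.2).2.inter hQ')
    (fun x => by
      by_cases hx : x ∈ Q
      · have := hc x
        simpa [Finsupp.sum, polytopeIndicator, Set.indicator_apply, hx, Finset.sum_filter] using this
      · simp [hx])
  simpa [Finsupp.sum, Finset.sum_filter] using this

end Euler

/-! ### Rank data of chains of flats are valuative -/

section Polytope

variable {E : Finset ℕ+} {M : Matroid ℕ+}

/-- The vertex `e_B` of the base polytope. -/
noncomputable def vertex (E : Finset ℕ+) (B : Set ℕ+) : E → ℝ :=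
  fun i : E => B.indicator (fun _ => (1 : ℝ)) (i : ℕ+)

open Classical in
/-- The linear functional `x ↦ ∑_{e ∈ A} x_e`. -/
noncomputable def coordSum (A : Set ℕ+) (x : E → ℝ) : ℝ := ∑ e : E, if (e : ℕ+) ∈ A then x e else 0

lemma coordSum_comb (A : Set ℕ+) (x y : E → ℝ) (a b : ℝ) :
    coordSum A (a • x + b • y) = a * coordSum A x + b * coordSum A y := by
  simp only [coordSum, Finset.mul_sum, ← Finset.sum_add_distrib]
  refine Finset.sum_congr rfl fun e _ => ?_
  split_ifs <;> simp

lemma coordSum_sum {ι : Type*} (A : Set ℕ+) (s : Finset ι) (w : ℝ) (x : ι → E → ℝ) :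
    coordSum A (∑ i ∈ s, w • x i) = ∑ i ∈ s, w * coordSum A (x i) := by
  simp only [coordSum, Finset.sum_apply, Pi.smul_apply, smul_eq_mul, Finset.mul_sum]
  rw [Finset.sum_comm]
  refine Finset.sum_congr rfl fun e _ => ?_
  split_ifs <;> simp

lemma continuous_coordSum (A : Set ℕ+) : Continuous (coordSum A : (E → ℝ) → ℝ) := by
  refine continuous_finsetSum _ fun e _ => ?_
  split_ifs
  · exact continuous_apply e
  · exact continuous_const

lemma coordSum_insert {A : Set ℕ+} {e : E} (he : (e : ℕ+) ∉ A) (x : E → ℝ) :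
    coordSum (insert (e : ℕ+) A) x = x e + coordSum A x := by
  classical
  unfold coordSum
  rw [← Finset.sum_erase_add _ _ (Finset.mem_univ e),
    ← Finset.sum_erase_add (a := e) (f := fun i : E => if (i : ℕ+) ∈ A then x i else 0) _
      (Finset.mem_univ e),
    if_pos (mem_insert _ _), if_neg he, add_zero, add_comm]
  congr 1
  refine Finset.sum_congr rfl fun i hi => ?_
  have hne : (i : ℕ+) ≠ e := fun h => (Finset.mem_erase.1 hi).1 (Subtype.ext h)
  simp [mem_insert_iff, hne]

lemma coordSum_vertex {B : Set ℕ+} (hB : B ⊆ ↑E) (A : Set ℕ+) :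
    coordSum A (vertex E B) = (A ∩ B).ncard := by
  classical
  have h : A ∩ B = ↑(E.filter (· ∈ A ∩ B)) := by
    ext e
    simp only [Finset.coe_filter, mem_inter_iff, mem_ofPred_eq]
    exact ⟨fun h => ⟨hB h.2, h⟩, fun h => h.2⟩
  rw [h, ncard_coe_finset, coordSum]
  unfold vertex
  rw [Finset.sum_coe_sort E (fun e => if e ∈ A then B.indicator (fun _ => (1 : ℝ)) e else 0),
    Finset.card_filter]
  push_cast
  refine Finset.sum_congr rfl fun e _ => ?_
  by_cases h1 : e ∈ A <;> by_cases h2 : e ∈ B <;> simp [h1, h2]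

lemma basePolytope_eq : basePolytope E M = convexHull ℝ {v | ∃ B, M.IsBase B ∧ v = vertex E B} :=
  rfl

lemma vertex_mem {B : Set ℕ+} (hB : M.IsBase B) : vertex E B ∈ basePolytope E M :=
  subset_convexHull ℝ _ ⟨B, hB, rfl⟩

lemma convex_basePolytope : Convex ℝ (basePolytope E M) := convex_convexHull ℝ _

lemma isCompact_basePolytope (hM : M.E = ↑E) : IsCompact (basePolytope E M) := by
  rw [basePolytope_eq]
  refine Set.Finite.isCompact_convexHull (𝕜 := ℝ) ?_
  have h : (vertex E '' (𝒫 (↑E : Set ℕ+))).Finite := E.finite_toSet.finite_subsets.image _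
  refine h.subset ?_
  rintro _ ⟨B, hB, rfl⟩
  exact ⟨B, hM ▸ hB.subset_ground, rfl⟩

lemma nonneg_of_mem_basePolytope {x : E → ℝ} (hx : x ∈ basePolytope E M) (e : E) : 0 ≤ x e := by
  have h : basePolytope E M ⊆ {x | 0 ≤ x e} := by
    refine convexHull_min ?_
      (convex_halfSpace_ge (f := fun x : E → ℝ => x e) (LinearMap.proj e).isLinear 0)
    rintro _ ⟨B, hB, rfl⟩
    exact indicator_nonneg (fun _ _ => zero_le_one' ℝ) _
  exact h hx

lemma coordSum_le_rk [M.RankFinite] (hM : M.E = ↑E) {x : E → ℝ} (hx : x ∈ basePolytope E M)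
    (A : Set ℕ+) : coordSum A x ≤ rk M A := by
  have h : basePolytope E M ⊆ {x | coordSum A x ≤ rk M A} := by
    refine convexHull_min ?_ ?_
    · rintro _ ⟨B, hB, rfl⟩
      have h1 := coordSum_vertex (hM ▸ hB.subset_ground) A
      have h2 := ncard_le_rk M (hB.indep.inter_left A) inter_subset_left
      change coordSum A (vertex E B) ≤ _
      rw [h1]
      exact_mod_cast h2
    · intro x hx y hy a b ha hb hab
      rw [mem_ofPred_eq] at *
      rw [coordSum_comb]
      nlinarith
  exact h hx

end Polytope

section RankData

variable {E : Finset ℕ+}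

/-- The total amount by which the coordinate sums of `x` over the members of `C` fall short of
the prescribed values. -/
noncomputable def deficit (C : Finset (Set ℕ+)) (r : Set ℕ+ → ℕ) (x : E → ℝ) : ℝ :=
  ∑ F ∈ C, ((r F : ℝ) - coordSum F x)

lemma deficit_comb (C : Finset (Set ℕ+)) (r : Set ℕ+ → ℕ) (x y : E → ℝ) {a b : ℝ}
    (hab : a + b = 1) :
    deficit C r (a • x + b • y) = a * deficit C r x + b * deficit C r y := by
  simp only [deficit, coordSum_comb, Finset.mul_sum, ← Finset.sum_add_distrib]
  refine Finset.sum_congr rfl fun F _ => ?_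
  linear_combination (-(r F : ℝ)) * hab

lemma continuous_deficit (C : Finset (Set ℕ+)) (r : Set ℕ+ → ℕ) :
    Continuous (deficit C r : (E → ℝ) → ℝ) := by
  unfold deficit
  exact continuous_finsetSum _ fun F _ => continuous_const.sub (continuous_coordSum F)

/-- The convex set detecting rank data: the coordinate sums over the members of `C` are at least
the prescribed ranks, and all coordinates are at least `1 / (|E| + 1)` when equality holds
throughout; this last condition relaxes to nonnegativity once the coordinate sums exceed the ranks
by `1` in total. -/
def rankRegion (E : Finset ℕ+) (C : Finset (Set ℕ+)) (r : Set ℕ+ → ℕ) : Set (E → ℝ) :=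
  {x | (∀ F ∈ C, (r F : ℝ) ≤ coordSum F x) ∧
    ∀ e : E, ((E.card : ℝ) + 1)⁻¹ * (1 + deficit C r x) ≤ x e}

/-- The part of the region where the coordinate sums exceed the ranks by `1` in total. -/
def excessRegion (E : Finset ℕ+) (C : Finset (Set ℕ+)) (r : Set ℕ+ → ℕ) : Set (E → ℝ) :=
  {x | (∀ F ∈ C, (r F : ℝ) ≤ coordSum F x) ∧ 1 + deficit C r x ≤ 0}

lemma isClosed_coordSum_ge (C : Finset (Set ℕ+)) (r : Set ℕ+ → ℕ) :
    IsClosed {x : E → ℝ | ∀ F ∈ C, (r F : ℝ) ≤ coordSum F x} := by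
  simp only [ofPred_forall]
  exact isClosed_iInter fun F => isClosed_iInter fun _ =>
    isClosed_le continuous_const (continuous_coordSum F)

lemma convex_coordSum_ge (C : Finset (Set ℕ+)) (r : Set ℕ+ → ℕ) :
    Convex ℝ {x : E → ℝ | ∀ F ∈ C, (r F : ℝ) ≤ coordSum F x} := by
  intro x hx y hy a b ha hb hab F hF
  rw [coordSum_comb]
  have h1 := mul_le_mul_of_nonneg_left (hx F hF) ha
  have h2 := mul_le_mul_of_nonneg_left (hy F hF) hb
  have h3 : (r F : ℝ) = a * r F + b * r F := by linear_combination (-(r F : ℝ)) * hab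
  linarith

lemma isClosed_rankRegion (C : Finset (Set ℕ+)) (r : Set ℕ+ → ℕ) :
    IsClosed (rankRegion E C r) := by
  refine IsClosed.inter (isClosed_coordSum_ge C r) (s₂ := {x | ∀ e : E, _}) ?_
  simp only [ofPred_forall]
  exact isClosed_iInter fun e => isClosed_le
    (continuous_const.mul (continuous_const.add (continuous_deficit C r))) (continuous_apply e)

lemma convex_rankRegion (C : Finset (Set ℕ+)) (r : Set ℕ+ → ℕ) :
    Convex ℝ (rankRegion E C r) := by
  refine (convex_coordSum_ge C r).inter (t := {x | ∀ e : E, _}) ?_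
  intro x hx y hy a b ha hb hab e
  rw [deficit_comb C r x y hab]
  have h1 := mul_le_mul_of_nonneg_left (hx e) ha
  have h2 := mul_le_mul_of_nonneg_left (hy e) hb
  have h3 : (a • x + b • y) e = a * x e + b * y e := by simp
  rw [h3]
  refine le_trans (le_of_eq ?_) (add_le_add h1 h2)
  linear_combination (-((E.card : ℝ) + 1)⁻¹) * hab

lemma isClosed_excessRegion (C : Finset (Set ℕ+)) (r : Set ℕ+ → ℕ) :
    IsClosed (excessRegion E C r) :=
  (isClosed_coordSum_ge C r).inter
    (isClosed_le (continuous_const.add (continuous_deficit C r)) continuous_const)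

lemma convex_excessRegion (C : Finset (Set ℕ+)) (r : Set ℕ+ → ℕ) :
    Convex ℝ (excessRegion E C r) := by
  refine (convex_coordSum_ge C r).inter (t := {x | 1 + deficit C r x ≤ 0}) ?_
  intro x hx y hy a b ha hb hab
  rw [mem_ofPred_eq] at *
  rw [deficit_comb C r x y hab]
  nlinarith [mul_nonneg ha (neg_nonneg.2 hx), mul_nonneg hb (neg_nonneg.2 hy)]

variable {M : Matroid ℕ+} [M.RankFinite] {C : Finset (Set ℕ+)} {r : Set ℕ+ → ℕ}

/-- If some member of `C` has smaller rank than prescribed, the polytope misses the region. -/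
lemma not_coordSum_ge_of_rk_lt (hM : M.E = ↑E) {F : Set ℕ+} (hF : F ∈ C) (h : rk M F < r F)
    {x : E → ℝ} (hx : x ∈ basePolytope E M) : ¬ ∀ F ∈ C, (r F : ℝ) ≤ coordSum F x := by
  intro h'
  have h1 := (h' F hF).trans (coordSum_le_rk hM hx F)
  have h2 : r F ≤ rk M F := by exact_mod_cast h1
  omega

omit [M.RankFinite] in
/-- If the ranks are at least those prescribed and are not all equal to them, then a vertex lies
in both regions. -/
lemma exists_mem_regions (hM : M.E = ↑E) (hCE : ∀ F ∈ C, F ⊆ M.E)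
    (hC : ∀ F ∈ C, ∀ G ∈ C, F ⊆ G ∨ G ⊆ F) (hle : ∀ F ∈ C, r F ≤ rk M F)
    (hlt : ∃ F ∈ C, r F < rk M F) :
    ∃ x ∈ basePolytope E M, x ∈ rankRegion E C r ∧ x ∈ excessRegion E C r := by
  obtain ⟨B, hB, hBC⟩ := exists_isBase_adapted M (hM ▸ E.finite_toSet) C hCE hC
  have hv : ∀ F ∈ C, coordSum F (vertex E B) = rk M F := fun F hF => by
    rw [coordSum_vertex (hM ▸ hB.subset_ground), hBC F hF]
  have h1 : ∀ F ∈ C, (r F : ℝ) ≤ coordSum F (vertex E B) := fun F hF => by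
    rw [hv F hF]
    exact_mod_cast hle F hF
  have h2 : 1 + deficit C r (vertex E B) ≤ 0 := by
    have e : deficit C r (vertex E B) = ((∑ F ∈ C, (r F : ℤ)) - ∑ F ∈ C, (rk M F : ℤ) : ℤ) := by
      rw [deficit, Finset.sum_sub_distrib, Finset.sum_congr rfl hv]
      push_cast
      rfl
    have h3 : ∑ F ∈ C, (r F : ℤ) < ∑ F ∈ C, (rk M F : ℤ) := by
      obtain ⟨F, hF, hF'⟩ := hlt
      exact Finset.sum_lt_sum (fun G hG => by exact_mod_cast hle G hG)
        ⟨F, hF, by exact_mod_cast hF'⟩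
    rw [e]
    have h4 : 1 + ((∑ F ∈ C, (r F : ℤ)) - ∑ F ∈ C, (rk M F : ℤ)) ≤ 0 := by omega
    exact_mod_cast h4
  refine ⟨vertex E B, vertex_mem hB, ⟨h1, fun e => ?_⟩, h1, h2⟩
  refine le_trans (mul_nonpos_of_nonneg_of_nonpos (by positivity) h2) ?_
  exact nonneg_of_mem_basePolytope (vertex_mem hB) e

/-- If all ranks are as prescribed, the polytope misses the excess region. -/
lemma notMem_excessRegion (hM : M.E = ↑E) (heq : ∀ F ∈ C, rk M F = r F) {x : E → ℝ}
    (hx : x ∈ basePolytope E M) : x ∉ excessRegion E C r := by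
  rintro ⟨-, h⟩
  have h1 : 0 ≤ deficit C r x := Finset.sum_nonneg fun F hF => by
    have := coordSum_le_rk hM hx F
    rw [heq F hF] at this
    linarith
  linarith

/-- If all ranks are as prescribed, the polytope meets the rank region exactly if the matroid is
loopless and the members of `C` are flats: a point with positive coordinates and maximal
coordinate sums excludes loops and elements of the closure, and the average of sufficiently many
adapted bases is such a point. -/
lemma meets_rankRegion_iff (hM : M.E = ↑E) (hCE : ∀ F ∈ C, F ⊆ M.E)
    (hC : ∀ F ∈ C, ∀ G ∈ C, F ⊆ G ∨ G ⊆ F) (heq : ∀ F ∈ C, rk M F = r F) :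
    (basePolytope E M ∩ rankRegion E C r).Nonempty ↔ M.Loopless ∧ ∀ F ∈ C, M.IsFlat F := by
  constructor
  · rintro ⟨x, hx, hxC, hxe⟩
    have hsum : ∀ F ∈ C, coordSum F x = r F := fun F hF =>
      le_antisymm (heq F hF ▸ coordSum_le_rk hM hx F) (hxC F hF)
    have hdef : deficit C r x = 0 := Finset.sum_eq_zero fun F hF => by rw [hsum F hF, sub_self]
    have hpos : ∀ e : E, 0 < x e := fun e => by
      refine lt_of_lt_of_le ?_ (hxe e)
      rw [hdef]
      positivity
    -- An element outside `A` but in its closure would have coordinate zero.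
    have key : ∀ A ⊆ M.E, coordSum A x = rk M A → M.IsFlat A := by
      intro A hA hAx
      rw [Matroid.isFlat_iff_closure_eq]
      refine subset_antisymm (fun e he => ?_) (M.subset_closure A hA)
      by_contra heA
      have heE : e ∈ E := by
        have := M.mem_ground_of_mem_closure he
        rwa [hM] at this
      have h1 := coordSum_le_rk hM hx (insert e A)
      rw [rk_eq_of_subset_closure M (subset_insert e A)
        (insert_subset he (M.subset_closure A hA)),
        coordSum_insert (e := ⟨e, heE⟩) heA, hAx] at h1
      linarith [hpos ⟨e, heE⟩]
    refine ⟨?_, fun F hF => key F (hCE F hF) (by rw [hsum F hF, heq F hF])⟩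
    have h0 := key ∅ (empty_subset _) (by simp [coordSum])
    rw [Matroid.loopless_iff, ← Matroid.closure_empty, h0.closure]
  · rintro ⟨hL, hF⟩
    have hfin : M.E.Finite := hM ▸ E.finite_toSet
    obtain ⟨B₀, hB₀, hB₀C⟩ := exists_isBase_adapted M hfin C hCE hC
    have hB : ∀ e : E, ∃ B, M.IsBase B ∧ (e : ℕ+) ∈ B ∧ ∀ F ∈ C, (F ∩ B).ncard = rk M F :=
      fun e => exists_isBase_adapted_mem M hL hfin C hF hC (hM ▸ e.2)
    choose B hB heB hBC using hB
    let B' : Option E → Set ℕ+ := fun o => o.elim B₀ B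
    have hB' : ∀ o, M.IsBase (B' o) := fun o => by cases o <;> simp [B', hB₀, hB]
    have hB'C : ∀ o, ∀ F ∈ C, (F ∩ B' o).ncard = rk M F := fun o => by
      cases o
      · exact hB₀C
      · exact hBC _
    let δ : ℝ := ((E.card : ℝ) + 1)⁻¹
    have hδ : 0 ≤ δ := by positivity
    have hδ1 : ∑ _o : Option E, δ = 1 := by
      rw [Finset.sum_const, Finset.card_univ, Fintype.card_option, Fintype.card_coe, nsmul_eq_mul]
      push_cast
      exact mul_inv_cancel₀ (by positivity)
    let x : E → ℝ := ∑ o : Option E, δ • vertex E (B' o)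
    have hx : x ∈ basePolytope E M :=
      convex_basePolytope.sum_mem (fun _ _ => hδ) hδ1 fun o _ => vertex_mem (hB' o)
    have hsum : ∀ F ∈ C, coordSum F x = r F := by
      intro F hF
      have : ∀ o ∈ (Finset.univ : Finset (Option E)),
          δ * coordSum F (vertex E (B' o)) = δ * r F := fun o _ => by
        rw [coordSum_vertex (hM ▸ (hB' o).subset_ground), hB'C o F hF, heq F hF]
      rw [coordSum_sum, Finset.sum_congr rfl this, ← Finset.sum_mul, hδ1, one_mul]
    refine ⟨x, hx, fun F hF => (hsum F hF).ge, fun e => ?_⟩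
    have hdef : deficit C r x = 0 := Finset.sum_eq_zero fun F hF => by rw [hsum F hF, sub_self]
    rw [hdef, add_zero, mul_one]
    have h1 : δ • vertex E (B' (some e)) e ≤ x e := by
      change _ ≤ (∑ o : Option E, δ • vertex E (B' o)) e
      rw [Finset.sum_apply]
      exact Finset.single_le_sum (f := fun o => (δ • vertex E (B' o)) e)
        (fun o _ => mul_nonneg hδ (indicator_nonneg (fun _ _ => zero_le_one) _))
        (Finset.mem_univ (some e))
    refine le_trans (le_of_eq ?_) h1
    simp [vertex, B', heB, δ]

end RankData

open Classical in
/-- For a fixed chain `C` and prescribed ranks, the property that the matroid is loopless and the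
members of `C` are flats of the prescribed ranks is a valuation: it is the difference of the
valuations counting whether the base polytope meets the rank region and the excess region. -/
lemma exists_hom_rank_data (E : Finset ℕ+) (C : Finset (Set ℕ+))
    (hC : ∀ F ∈ C, ∀ G ∈ C, F ⊆ G ∨ G ⊆ F) (r : Set ℕ+ → ℕ) :
    ∃ χ : indicatorSubgroup (matroidPolytopes E) →+ ℤ, ∀ (M : FinMatroid) (hM : M.1.E = ↑E),
      χ (indicatorOf (matroidPolytopes E) ⟨basePolytope E M.1, M, hM, rfl⟩) =
        if M.1.Loopless ∧ ∀ F ∈ C, M.1.IsFlat F ∧ rk M.1 F = r F then 1 else 0 := by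
  by_cases hCE : ∀ F ∈ C, F ⊆ (↑E : Set ℕ+)
  swap
  · refine ⟨0, fun M hM => ?_⟩
    rw [if_neg]
    · rfl
    · rintro ⟨-, h⟩
      exact hCE fun F hF => hM ▸ (h F hF).1.subset_ground
  have hP : ∀ P ∈ matroidPolytopes E, IsCompact P ∧ Convex ℝ P := by
    rintro _ ⟨M, hM, rfl⟩
    exact ⟨isCompact_basePolytope hM, convex_basePolytope⟩
  obtain ⟨χ₁, h₁⟩ := exists_hom_meets _ hP (isClosed_rankRegion C r) (convex_rankRegion C r)
  obtain ⟨χ₂, h₂⟩ := exists_hom_meets _ hP (isClosed_excessRegion C r) (convex_excessRegion C r)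
  refine ⟨χ₁ - χ₂, fun M hM => ?_⟩
  have : M.1.Finite := ⟨M.2⟩
  rw [← hM] at hCE
  rw [AddMonoidHom.sub_apply, h₁, h₂]
  dsimp only
  by_cases hle : ∀ F ∈ C, r F ≤ rk M.1 F
  · by_cases hlt : ∃ F ∈ C, r F < rk M.1 F
    · obtain ⟨x, hx, hx₁, hx₂⟩ := exists_mem_regions hM hCE hC hle hlt
      rw [if_pos ⟨x, hx, hx₁⟩, if_pos ⟨x, hx, hx₂⟩, if_neg]
      · simp
      · rintro ⟨-, h⟩
        obtain ⟨F, hF, hF'⟩ := hlt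
        exact hF'.ne' (h F hF).2
    · have heq : ∀ F ∈ C, rk M.1 F = r F := fun F hF =>
        le_antisymm (not_lt.1 fun h => hlt ⟨F, hF, h⟩) (hle F hF)
      have h3 : ¬ (basePolytope E M.1 ∩ excessRegion E C r).Nonempty := fun ⟨x, hx, hx'⟩ =>
        notMem_excessRegion hM heq hx hx'
      rw [if_neg h3, sub_zero]
      refine if_congr ?_ rfl rfl
      rw [meets_rankRegion_iff hM hCE hC heq]
      exact and_congr_right fun _ =>
        ⟨fun h F hF => ⟨h F hF, heq F hF⟩, fun h F hF => (h F hF).1⟩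
  · push Not at hle
    obtain ⟨F, hF, hFlt⟩ := hle
    have h1 : ¬ (basePolytope E M.1 ∩ rankRegion E C r).Nonempty := fun ⟨x, hx, hx'⟩ =>
      not_coordSum_ge_of_rk_lt hM hF hFlt hx hx'.1
    have h2 : ¬ (basePolytope E M.1 ∩ excessRegion E C r).Nonempty := fun ⟨x, hx, hx'⟩ =>
      not_coordSum_ge_of_rk_lt hM hF hFlt hx hx'.1
    rw [if_neg h1, if_neg h2, if_neg]
    · simp
    · rintro ⟨-, h⟩
      exact hFlt.ne (h F hF).2

/-! ### Normal exponents and the counting polynomial -/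

/-- The conditions on an exponent vector that depend only on the ranks `r F` of the sets in its
support: the support is a chain of nonempty sets, and each exponent is smaller than the jump in
rank from the preceding set of the chain, or from the empty set. -/
structure IsRankNormal (r : Set ℕ+ → ℕ) (d : Set ℕ+ →₀ ℕ) : Prop where
  nonempty : ∀ F ∈ d.support, F.Nonempty
  chain : ∀ F ∈ d.support, ∀ G ∈ d.support, F ⊆ G ∨ G ⊆ F
  lt : ∀ F ∈ d.support, d F < r F
  add_lt : ∀ F ∈ d.support, ∀ G ∈ d.support, G ⊂ F → d F + r G < r F

lemma IsRankNormal.congr {r r' : Set ℕ+ → ℕ} {d : Set ℕ+ →₀ ℕ} (h : IsRankNormal r d)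
    (hr : ∀ F ∈ d.support, r F = r' F) : IsRankNormal r' d where
  nonempty := h.nonempty
  chain := h.chain
  lt F hF := hr F hF ▸ h.lt F hF
  add_lt F hF G hG hGF := hr F hF ▸ hr G hG ▸ h.add_lt F hF G hG hGF

/-- The exponents of the monomials in the generators `h_F` (`F` a nonempty flat) that form a basis
of the Chow ring. Exponents are indexed by all sets, so that they can be compared between different
matroids. -/
structure IsNormal (M : Matroid ℕ+) (d : Set ℕ+ →₀ ℕ) : Prop where
  isFlat : ∀ F ∈ d.support, M.IsFlat F
  rankNormal : IsRankNormal (rk M) d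

open Classical in
/-- The exponent vectors supported on subsets of `E` with entries at most `|E|`. -/
noncomputable def boundedExponents (E : Finset ℕ+) : Finset (Set ℕ+ →₀ ℕ) :=
  Finset.finsupp (E.powerset.image fun F : Finset ℕ+ => (F : Set ℕ+))
    fun _ => Finset.range (E.card + 1)

lemma rk_le_card {E : Finset ℕ+} {M : Matroid ℕ+} [M.RankFinite] (hM : M.E = ↑E) {F : Set ℕ+}
    (hF : F ⊆ M.E) : rk M F ≤ E.card := by
  rw [hM] at hF
  refine (rk_le_ncard M (E.finite_toSet.subset hF)).trans ?_
  rw [← ncard_coe_finset]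
  exact ncard_le_ncard hF

lemma IsNormal.mem_boundedExponents {E : Finset ℕ+} {M : Matroid ℕ+} [M.RankFinite]
    (hM : M.E = ↑E) {d : Set ℕ+ →₀ ℕ} (h : IsNormal M d) : d ∈ boundedExponents E := by
  classical
  have hF : ∀ F ∈ d.support, F ⊆ (↑E : Set ℕ+) := fun F hF => hM ▸ (h.isFlat F hF).subset_ground
  rw [boundedExponents, Finset.mem_finsupp_iff]
  refine ⟨fun F hFd => ?_, fun F _ => ?_⟩
  · rw [Finset.mem_image]
    have hfin := E.finite_toSet.subset (hF F hFd)
    refine ⟨hfin.toFinset, ?_, hfin.coe_toFinset⟩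
    rw [Finset.mem_powerset, ← Finset.coe_subset, hfin.coe_toFinset]
    exact hF F hFd
  · rw [Finset.mem_range]
    by_cases hFd : F ∈ d.support
    · have h1 := h.rankNormal.lt F hFd
      have h2 := rk_le_card hM (h.isFlat F hFd).subset_ground
      omega
    · rw [Finsupp.notMem_support_iff.1 hFd]
      omega

lemma finite_isNormal (M : FinMatroid) : {d | IsNormal M.1 d}.Finite := by
  have : M.1.Finite := ⟨M.2⟩
  exact (boundedExponents M.2.toFinset).finite_toSet.subset
    fun d hd => IsNormal.mem_boundedExponents (by simp) hd

/-- The finite set of normal exponents of a matroid. -/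
noncomputable def normalExponents (M : FinMatroid) : Finset (Set ℕ+ →₀ ℕ) :=
  (finite_isNormal M).toFinset

@[simp] lemma mem_normalExponents {M : FinMatroid} {d : Set ℕ+ →₀ ℕ} :
    d ∈ normalExponents M ↔ IsNormal M.1 d := by
  simp [normalExponents]

open Classical in
/-- The generating polynomial of the normal exponents by degree for a loopless matroid, and zero
for a matroid with loops. -/
noncomputable def countingPolynomial (M : FinMatroid) : Polynomial ℤ :=
  if M.1.Loopless then ∑ d ∈ normalExponents M, Polynomial.X ^ d.degree else 0

/-! ### The counting polynomial is a valuation -/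

open Classical in
/-- The property that the matroid is loopless and a fixed exponent is normal is a valuation:
it is the sum of the rank data valuations over all rank functions on the support for which the
exponent is normal. -/
lemma exists_hom_isNormal (E : Finset ℕ+) (d : Set ℕ+ →₀ ℕ) :
    ∃ χ : indicatorSubgroup (matroidPolytopes E) →+ ℤ, ∀ (M : FinMatroid) (hM : M.1.E = ↑E),
      χ (indicatorOf (matroidPolytopes E) ⟨basePolytope E M.1, M, hM, rfl⟩) =
        if M.1.Loopless ∧ IsNormal M.1 d then 1 else 0 := by
  by_cases hC : ∀ F ∈ d.support, ∀ G ∈ d.support, F ⊆ G ∨ G ⊆ F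
  swap
  · refine ⟨0, fun M hM => ?_⟩
    rw [if_neg]
    · rfl
    · rintro ⟨-, h⟩
      exact hC h.rankNormal.chain
  choose χ hχ using fun r : Set ℕ+ →₀ ℕ => exists_hom_rank_data E d.support hC r
  let R : Finset (Set ℕ+ →₀ ℕ) :=
    (Finset.finsupp d.support fun _ => Finset.range (E.card + 1)).filter
      fun r => IsRankNormal r d
  refine ⟨∑ r ∈ R, χ r, fun M hM => ?_⟩
  have : M.1.Finite := ⟨M.2⟩
  rw [AddMonoidHom.finsetSum_apply, Finset.sum_congr rfl fun r _ => hχ r M hM]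
  split_ifs with h
  · obtain ⟨hL, hN⟩ := h
    let r₀ : Set ℕ+ →₀ ℕ := Finsupp.onFinset d.support
      (fun F => if F ∈ d.support then rk M.1 F else 0) fun F hF => by
        by_contra h
        exact hF (if_neg h)
    have hr₀ : ∀ F ∈ d.support, r₀ F = rk M.1 F := fun F hF => if_pos hF
    have hr₀R : r₀ ∈ R := by
      rw [Finset.mem_filter, Finset.mem_finsupp_iff]
      refine ⟨⟨Finsupp.support_onFinset_subset, fun F hF => ?_⟩,
        hN.rankNormal.congr fun F hF => (hr₀ F hF).symm⟩
      rw [hr₀ F hF, Finset.mem_range, Nat.lt_succ_iff]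
      exact rk_le_card hM (hN.isFlat F hF).subset_ground
    rw [Finset.sum_eq_single_of_mem r₀ hr₀R]
    · rw [if_pos ⟨hL, fun F hF => ⟨hN.isFlat F hF, (hr₀ F hF).symm⟩⟩]
    · intro r hr hne
      rw [if_neg]
      rintro ⟨-, h⟩
      apply hne
      rw [Finset.mem_filter, Finset.mem_finsupp_iff] at hr
      ext F
      by_cases hF : F ∈ d.support
      · rw [hr₀ F hF, (h F hF).2]
      · rw [Finsupp.notMem_support_iff.1 fun h => hF (hr.1.1 h)]
        exact (if_neg hF).symm
  · refine Finset.sum_eq_zero fun r hr => if_neg ?_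
    rintro ⟨hL, h'⟩
    rw [Finset.mem_filter] at hr
    exact h ⟨hL, fun F hF => (h' F hF).1, hr.2.congr fun F hF => (h' F hF).2.symm⟩

lemma isValuation_countingPolynomial : IsValuation countingPolynomial := by
  classical
  intro E
  choose χ hχ using exists_hom_isNormal E
  refine ⟨∑ d ∈ boundedExponents E,
    (zmultiplesHom (Polynomial ℤ) (Polynomial.X ^ d.degree)).comp (χ d), fun M hM => ?_⟩
  have : M.1.Finite := ⟨M.2⟩
  rw [AddMonoidHom.finsetSum_apply]
  simp only [AddMonoidHom.comp_apply, hχ _ M hM, zmultiplesHom_apply, ite_smul, one_smul,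
    zero_smul]
  rw [countingPolynomial]
  split_ifs with hL
  · simp only [hL, true_and]
    rw [← Finset.sum_filter]
    refine Finset.sum_congr ?_ fun _ _ => rfl
    ext d
    rw [mem_normalExponents, Finset.mem_filter]
    exact ⟨fun h => ⟨h.mem_boundedExponents hM, h⟩, fun h => h.2⟩
  · simp [hL]

/-! ### The counting polynomial is an invariant -/

section Invariance

variable {M N : Matroid ℕ+} {f : ℕ+ → ℕ+} {hf : InjOn f M.E}

lemma rk_map {A : Set ℕ+} (hA : A ⊆ M.E) : rk (M.map f hf) (f '' A) = rk M A := by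
  rw [rk, rk, Matroid.eRk_map M hf hA]

lemma isFlat_map [M.RankFinite] {A : Set ℕ+} (h : M.IsFlat A) :
    (M.map f hf).IsFlat (f '' A) := by
  rw [Matroid.isFlat_iff_closure_eq]
  have hA : f '' A ⊆ (M.map f hf).E := image_mono h.subset_ground
  refine subset_antisymm (fun y hy => ?_) (Matroid.subset_closure _ _ hA)
  obtain ⟨e, he, rfl⟩ : y ∈ f '' M.E := (M.map f hf).mem_ground_of_mem_closure hy
  by_contra heA
  have h1 : e ∉ A := fun h => heA (mem_image_of_mem f h)
  have h2 := rk_insert_of_notMem_closure M (A := A) he (by rwa [h.closure])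
  rw [← rk_map (hf := hf) (insert_subset he h.subset_ground),
    ← rk_map (hf := hf) h.subset_ground, image_insert_eq, rk, rk] at h2
  have h3 : (M.map f hf).eRk (insert (f e) (f '' A)) = (M.map f hf).eRk (f '' A) := by
    rw [← Matroid.eRk_closure_eq, Matroid.closure_insert_eq_of_mem_closure hy,
      Matroid.eRk_closure_eq]
  rw [h3] at h2
  omega

open Classical in
lemma mapDomain_image_apply {E : Set ℕ+} (hf : InjOn f E) {d : Set ℕ+ →₀ ℕ}
    (hd : ∀ F ∈ d.support, F ⊆ E) {F : Set ℕ+} (hF : F ∈ d.support) :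
    d.mapDomain (image f) (f '' F) = d F :=
  Finsupp.mapDomain_apply' (𝒫 E) d (fun F hF => hd F hF)
    (fun _ hA _ hB => (hf.image_eq_image_iff hA hB).1) (hd F hF)

open Classical in
lemma IsNormal.map [M.RankFinite] {d : Set ℕ+ →₀ ℕ} (h : IsNormal M d) :
    IsNormal (M.map f hf) (d.mapDomain (image f)) := by
  have hd : ∀ F ∈ d.support, F ⊆ M.E := fun F hF => (h.isFlat F hF).subset_ground
  have hsupp : ∀ G ∈ (d.mapDomain (image f)).support, ∃ F ∈ d.support, f '' F = G := fun G hG => by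
    simpa using Finsupp.mapDomain_support hG
  refine ⟨fun G hG => ?_, fun G hG => ?_, fun G hG G' hG' => ?_, fun G hG => ?_,
    fun G hG G' hG' hss => ?_⟩
  all_goals obtain ⟨F, hF, rfl⟩ := hsupp G hG
  · exact isFlat_map (h.isFlat F hF)
  · exact (h.rankNormal.nonempty F hF).image f
  · obtain ⟨F', hF', rfl⟩ := hsupp G' hG'
    exact (h.rankNormal.chain F hF F' hF').imp (fun h => image_mono h) (fun h => image_mono h)
  · rw [mapDomain_image_apply hf hd hF, rk_map (hd F hF)]
    exact h.rankNormal.lt F hF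
  · obtain ⟨F', hF', rfl⟩ := hsupp G' hG'
    rw [mapDomain_image_apply hf hd hF, rk_map (hd F hF), rk_map (hd F' hF')]
    refine h.rankNormal.add_lt F hF F' hF' ?_
    rw [ssubset_iff_subset_ne] at hss ⊢
    exact ⟨(hf.image_subset_image_iff (hd F' hF') (hd F hF)).1 hss.1,
      fun he => hss.2 (he ▸ rfl)⟩

/-- An isomorphism is realized by a relabelling of the ground set, with a relabelling back. -/
lemma Isomorphic.exists_map {M N : FinMatroid} (h : Isomorphic M N) :
    ∃ f g : ℕ+ → ℕ+, ∃ hf : InjOn f M.1.E, ∃ hg : InjOn g N.1.E,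
      N.1 = M.1.map f hf ∧ M.1 = N.1.map g hg ∧ (∀ x ∈ M.1.E, g (f x) = x) ∧
        ∀ y ∈ N.1.E, f (g y) = y := by
  classical
  obtain ⟨φ, hφ⟩ := h
  let f : ℕ+ → ℕ+ := fun x => if h : x ∈ M.1.E then φ ⟨x, h⟩ else x
  let g : ℕ+ → ℕ+ := fun y => if h : y ∈ N.1.E then φ.symm ⟨y, h⟩ else y
  have hfE : ∀ x : M.1.E, f x = φ x := fun x => by simp [f]
  have hgE : ∀ y : N.1.E, g y = φ.symm y := fun y => by simp [g]
  have hgf : ∀ x ∈ M.1.E, g (f x) = x := fun x hx => by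
    rw [hfE ⟨x, hx⟩, hgE, φ.symm_apply_apply]
  have hfg : ∀ y ∈ N.1.E, f (g y) = y := fun y hy => by
    rw [hgE ⟨y, hy⟩, hfE, φ.apply_symm_apply]
  have hf : InjOn f M.1.E := LeftInvOn.injOn hgf
  have hg : InjOn g N.1.E := LeftInvOn.injOn hfg
  have hfim : ∀ B : Set M.1.E, f '' (Subtype.val '' B) = Subtype.val '' (φ '' B) := fun B => by
    rw [image_image, image_image]
    exact image_congr fun x _ => hfE x
  have himg : f '' M.1.E = N.1.E := by
    have := hfim univ
    rwa [image_univ, image_univ, Subtype.range_coe, φ.range_eq_univ, image_univ,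
      Subtype.range_coe] at this
  have hgimg : g '' N.1.E = M.1.E := by
    rw [← himg, image_image]
    exact (image_congr fun x hx => hgf x hx).trans (image_id' _)
  have hbase : ∀ B ⊆ M.1.E, N.1.IsBase (f '' B) ↔ M.1.IsBase B := fun B hB => by
    have := hφ (Subtype.val ⁻¹' B)
    rwa [← hfim, Subtype.image_preimage_coe, inter_eq_self_of_subset_right hB] at this
  have hgfB : ∀ B ⊆ M.1.E, g '' (f '' B) = B := fun B hB => by
    rw [image_image]
    exact (image_congr fun x hx => hgf x (hB hx)).trans (image_id' _)
  have hfgB : ∀ B ⊆ N.1.E, f '' (g '' B) = B := fun B hB => by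
    rw [image_image]
    exact (image_congr fun x hx => hfg x (hB hx)).trans (image_id' _)
  refine ⟨f, g, hf, hg, ?_, ?_, hgf, hfg⟩
  · refine Matroid.ext_isBase himg.symm fun B hB => ?_
    have hgB : g '' B ⊆ M.1.E := hgimg ▸ image_mono hB
    rw [← hfgB B hB, hbase _ hgB, Matroid.map_image_isBase_iff hgB]
  · refine Matroid.ext_isBase hgimg.symm fun B hB => ?_
    have hfB : f '' B ⊆ N.1.E := himg ▸ image_mono hB
    rw [← hbase B hB]
    conv_rhs => rw [← hgfB B hB]
    rw [Matroid.map_image_isBase_iff hfB]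

open Classical in
lemma mapDomain_image_leftInverse {E : Set ℕ+} {f g : ℕ+ → ℕ+} (h : ∀ x ∈ E, g (f x) = x)
    {d : Set ℕ+ →₀ ℕ} (hd : ∀ F ∈ d.support, F ⊆ E) :
    (d.mapDomain (image f)).mapDomain (image g) = d := by
  rw [← Finsupp.mapDomain_comp]
  refine (Finsupp.mapDomain_congr fun F hF => ?_).trans Finsupp.mapDomain_id
  rw [Function.comp_apply, image_image]
  exact (image_congr fun x hx => h x (hd F hF hx)).trans (image_id' _)

lemma isInvariant_countingPolynomial : IsInvariant countingPolynomial := by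
  classical
  intro M N h
  have : M.1.Finite := ⟨M.2⟩
  have : N.1.Finite := ⟨N.2⟩
  obtain ⟨f, g, hf, hg, hN, hM, hgf, hfg⟩ := h.exists_map
  have hL : M.1.Loopless ↔ N.1.Loopless := by
    rw [Matroid.loopless_iff, Matroid.loopless_iff, hN, Matroid.map_loops, image_eq_empty]
  rw [countingPolynomial, countingPolynomial]
  refine if_congr hL ?_ rfl
  refine Finset.sum_bij' (fun d _ => d.mapDomain (image f)) (fun d _ => d.mapDomain (image g))
    ?_ ?_ ?_ ?_ ?_
  · intro d hd
    rw [mem_normalExponents] at hd ⊢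
    rw [hN]
    exact hd.map
  · intro d hd
    rw [mem_normalExponents] at hd ⊢
    rw [hM]
    exact hd.map
  · intro d hd
    rw [mem_normalExponents] at hd
    exact mapDomain_image_leftInverse hgf fun F hF => (hd.isFlat F hF).subset_ground
  · intro d hd
    rw [mem_normalExponents] at hd
    exact mapDomain_image_leftInverse hfg fun F hF => (hd.isFlat F hF).subset_ground
  · intro d _
    rw [Finsupp.degree_mapDomain]

end Invariance

/-! ### The generators `h_F` of the Chow ring -/

section Nef

variable (M : FinMatroid)

instance finite_ground : M.1.Finite := ⟨M.2⟩

/-- The class of `x_F` in the Chow ring. -/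
noncomputable def chowX (F : ProperFlat M) : ChowRing M :=
  Ideal.Quotient.mk _ (MvPolynomial.X F)

open Classical in
/-- The common class of the linear forms `∑_{F ∋ i} x_F` for `i ∈ E`, and zero if `E = ∅`. -/
noncomputable def chowAlpha : ChowRing M :=
  if h : M.1.E.Nonempty then Ideal.Quotient.mk _ (flatSum M h.some) else 0

open Classical in
/-- The element `h_A = ∑_{F ⊇ A} x_F`, where the sum runs over all nonempty flats and `x_E`
stands for `-α`. -/
noncomputable def nef (A : Set ℕ+) : ChowRing M :=
  ∑ F : ProperFlat M with A ⊆ F.1, chowX M F - chowAlpha M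

open Classical in
lemma mk_flatSum (i : ℕ+) :
    (Ideal.Quotient.mk _ (flatSum M i) : ChowRing M) =
      ∑ F : ProperFlat M with i ∈ F.1, chowX M F := by
  rw [flatSum, map_sum]
  rfl

open Classical in
lemma chowAlpha_eq {i : ℕ+} (hi : i ∈ M.1.E) :
    chowAlpha M = ∑ F : ProperFlat M with i ∈ F.1, chowX M F := by
  have h : M.1.E.Nonempty := ⟨i, hi⟩
  rw [chowAlpha, dif_pos h, ← mk_flatSum, Ideal.Quotient.eq]
  exact Ideal.mem_sup_right (Ideal.subset_span ⟨_, h.some_mem, i, hi, rfl⟩)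

lemma chowX_mul_eq_zero {F G : ProperFlat M} (h : ¬ F.1 ⊆ G.1) (h' : ¬ G.1 ⊆ F.1) :
    chowX M F * chowX M G = 0 := by
  rw [chowX, chowX, ← map_mul, Ideal.Quotient.eq_zero_iff_mem]
  exact Ideal.mem_sup_left (Ideal.subset_span ⟨F, G, h, h', rfl⟩)

lemma nef_singleton {i : ℕ+} (hi : i ∈ M.1.E) : nef M {i} = 0 := by
  classical
  rw [nef, chowAlpha_eq M hi, sub_eq_zero]
  exact Finset.sum_congr (Finset.filter_congr fun F _ => singleton_subset_iff) fun _ _ => rfl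

lemma nef_closure {A : Set ℕ+} (hA : A ⊆ M.1.E) : nef M (M.1.closure A) = nef M A := by
  rw [nef, nef]
  congr 2
  ext F
  simp only [Finset.mem_filter, Finset.mem_univ, true_and]
  refine ⟨(M.1.subset_closure A hA).trans, fun h => ?_⟩
  rw [← F.2.1.closure]
  exact M.1.closure_subset_closure h

open Classical in
lemma nef_sub_nef_union (A B : Set ℕ+) :
    nef M A - nef M (A ∪ B) = ∑ F : ProperFlat M with A ⊆ F.1 ∧ ¬ B ⊆ F.1, chowX M F := by
  rw [nef, nef, sub_sub_sub_cancel_right, sub_eq_iff_eq_add, ← Finset.filter_filter,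
    add_comm]
  have h : (Finset.univ.filter fun F : ProperFlat M => A ∪ B ⊆ F.1) =
      (Finset.univ.filter fun F : ProperFlat M => A ⊆ F.1).filter (B ⊆ ·.1) := by
    rw [Finset.filter_filter]
    exact Finset.filter_congr fun F _ => union_subset_iff
  rw [h, Finset.sum_filter_add_sum_filter_not]

/-- The quadratic relations: in the expansion, a flat containing `A` but not `B` is incomparable to
a flat containing `B` but not `A`. -/
lemma nef_sub_mul_nef_sub (A B : Set ℕ+) :
    (nef M A - nef M (A ∪ B)) * (nef M B - nef M (A ∪ B)) = 0 := by
  classical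
  rw [nef_sub_nef_union, union_comm, nef_sub_nef_union, Finset.sum_mul_sum]
  refine Finset.sum_eq_zero fun F hF => Finset.sum_eq_zero fun G hG => ?_
  simp only [Finset.mem_filter, Finset.mem_univ, true_and] at hF hG
  exact chowX_mul_eq_zero M (fun h => hG.2 (hF.1.trans h)) (fun h => hF.2 (hG.1.trans h))

lemma nef_mul_nef_insert {i : ℕ+} (hi : i ∈ M.1.E) (A : Set ℕ+) :
    nef M A * nef M (insert i A) = nef M (insert i A) ^ 2 := by
  have h := nef_sub_mul_nef_sub M A {i}
  rw [nef_singleton M hi, union_singleton] at h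
  linear_combination -h

lemma nef_mul_nef_union_pow (A : Set ℕ+) (T : Finset ℕ+) (hT : (T : Set ℕ+) ⊆ M.1.E) :
    nef M A * nef M (A ∪ T) ^ T.card = nef M (A ∪ T) ^ (T.card + 1) := by
  classical
  induction T using Finset.induction_on with
  | empty => simp
  | insert i T hi ih =>
    rw [Finset.coe_insert, insert_subset_iff] at hT
    have ih := ih hT.2
    have h := nef_mul_nef_insert M hT.1 (A ∪ T)
    -- Powers of `h_{A ∪ T}` are absorbed by a single factor `h_{A ∪ T ∪ {i}}`.
    have hpow : ∀ k, nef M (A ∪ T) ^ k * nef M (insert i (A ∪ T)) =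
        nef M (insert i (A ∪ T)) ^ (k + 1) := by
      intro k
      induction k with
      | zero => simp
      | succ k ihk =>
        calc nef M (A ∪ T) ^ (k + 1) * nef M (insert i (A ∪ T))
            = nef M (A ∪ T) * (nef M (A ∪ T) ^ k * nef M (insert i (A ∪ T))) := by ring
          _ = nef M (A ∪ T) * nef M (insert i (A ∪ T)) * nef M (insert i (A ∪ T)) ^ k := by
            rw [ihk]; ring
          _ = _ := by rw [h]; ring
    rw [Finset.card_insert_of_notMem hi, Finset.coe_insert, union_insert]
    calc nef M A * nef M (insert i (A ∪ T)) ^ (T.card + 1)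
        = nef M A * nef M (A ∪ T) ^ T.card * nef M (insert i (A ∪ T)) := by
          rw [← hpow T.card]; ring
      _ = nef M (A ∪ T) ^ (T.card + 1) * nef M (insert i (A ∪ T)) := by rw [ih]
      _ = _ := hpow _

lemma nef_mul_nef_pow {F G : Set ℕ+} (hF : M.1.IsFlat F) (hG : M.1.IsFlat G) (h : F ⊆ G) :
    nef M F * nef M G ^ (rk M.1 G - rk M.1 F) = nef M G ^ (rk M.1 G - rk M.1 F + 1) := by
  obtain ⟨T, hT, hcard, hcl⟩ := exists_finset_closure_union_eq M.1 hF hG h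
  have := nef_mul_nef_union_pow M F T hT
  rwa [hcard, ← nef_closure M (union_subset hF.subset_ground hT), hcl] at this

lemma nef_pow_rk (hL : M.1.Loopless) {G : Set ℕ+} (hG : M.1.IsFlat G) (hne : G.Nonempty) :
    nef M G ^ rk M.1 G = 0 := by
  obtain ⟨i, hi⟩ := hne
  have hiE := hG.subset_ground hi
  have h1 : M.1.closure {i} ⊆ G := by
    rw [← hG.closure]
    exact M.1.closure_subset_closure (singleton_subset_iff.2 hi)
  have h2 := nef_mul_nef_pow M (M.1.isFlat_closure {i}) hG h1
  have h3 : rk M.1 (M.1.closure {i}) = 1 := by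
    rw [rk_closure]
    have := rk_insert_le M.1 i ∅
    have := rk_pos M.1 hL (singleton_subset_iff.2 hiE) (singleton_nonempty i)
    simp only [insert_empty_eq, rk_empty] at *
    omega
  have h4 := rk_pos M.1 hL hG.subset_ground ⟨i, hi⟩
  rw [nef_closure M (singleton_subset_iff.2 hiE), nef_singleton M hiE, zero_mul, h3,
    Nat.sub_add_cancel h4] at h2
  exact h2.symm

/-! ### Normal monomials span the Chow ring -/

/-- A nonempty flat. -/
def IsNonemptyFlat (F : Set ℕ+) : Prop := M.1.IsFlat F ∧ F.Nonempty

/-- The monomial in the generators `h_F` with the given exponents. -/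
noncomputable def nefMonomial (d : Set ℕ+ →₀ ℕ) : ChowRing M := d.prod fun F k => nef M F ^ k

lemma nefMonomial_add (d e : Set ℕ+ →₀ ℕ) :
    nefMonomial M (d + e) = nefMonomial M d * nefMonomial M e :=
  Finsupp.prod_add_index' (fun _ => pow_zero _) fun _ _ _ => pow_add _ _ _

@[simp] lemma nefMonomial_single (F : Set ℕ+) (k : ℕ) :
    nefMonomial M (Finsupp.single F k) = nef M F ^ k :=
  Finsupp.prod_single_index (pow_zero _)

/-- The total rank of an exponent vector, with multiplicities. The straightening relations
increase it. -/
noncomputable def rankWeight (M : Matroid ℕ+) (d : Set ℕ+ →₀ ℕ) : ℕ := d.sum fun F k => k * rk M F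

lemma rankWeight_add (M : Matroid ℕ+) (d e : Set ℕ+ →₀ ℕ) :
    rankWeight M (d + e) = rankWeight M d + rankWeight M e :=
  Finsupp.sum_add_index' (fun _ => zero_mul _) fun _ _ _ => add_mul _ _ _

@[simp] lemma rankWeight_single (M : Matroid ℕ+) (F : Set ℕ+) (k : ℕ) :
    rankWeight M (Finsupp.single F k) = k * rk M F :=
  Finsupp.sum_single_index (zero_mul _)

lemma rankWeight_le {d : Set ℕ+ →₀ ℕ} (hd : ∀ F ∈ d.support, IsNonemptyFlat M F) :
    rankWeight M.1 d ≤ d.degree * rk M.1 M.1.E := by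
  rw [rankWeight, Finsupp.sum, Finsupp.degree_apply, Finset.sum_mul]
  exact Finset.sum_le_sum fun F hF =>
    Nat.mul_le_mul_left _ (rk_mono M.1 (hd F hF).1.subset_ground)

/-- An exponent vector that is not normal can be straightened: its monomial is a combination of
monomials of the same degree and larger rank weight. -/
lemma exists_straightening (hL : M.1.Loopless) {d : Set ℕ+ →₀ ℕ}
    (hd : ∀ F ∈ d.support, IsNonemptyFlat M F) (hN : ¬ IsNormal M.1 d) :
    nefMonomial M d ∈ Submodule.span ℚ (nefMonomial M ''
      {e | (∀ F ∈ e.support, IsNonemptyFlat M F) ∧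
        e.degree = d.degree ∧ rankWeight M.1 d < rankWeight M.1 e}) := by
  classical
  set S := nefMonomial M '' {e | (∀ F ∈ e.support, IsNonemptyFlat M F) ∧
      e.degree = d.degree ∧ rankWeight M.1 d < rankWeight M.1 e} with hS
  have hsupp : ∀ {c e : Set ℕ+ →₀ ℕ}, (∀ F ∈ c.support, IsNonemptyFlat M F) →
      (∀ F ∈ e.support, IsNonemptyFlat M F) → ∀ F ∈ (c + e).support, IsNonemptyFlat M F :=
    fun hc he F hF => (Finset.mem_union.1 (Finsupp.support_add hF)).elim (hc F) (he F)
  have hsingle : ∀ {F : Set ℕ+} (k : ℕ), IsNonemptyFlat M F →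
      ∀ G ∈ (Finsupp.single F k).support, IsNonemptyFlat M G := fun k hF G hG => by
    rw [Finset.mem_singleton.1 (Finsupp.support_single_subset hG)]
    exact hF
  by_cases hchain : ∀ F ∈ d.support, ∀ G ∈ d.support, F ⊆ G ∨ G ⊆ F
  · by_cases hlt : ∀ F ∈ d.support, d F < rk M.1 F
    · by_cases hadd : ∀ F ∈ d.support, ∀ G ∈ d.support, G ⊂ F → d F + rk M.1 G < rk M.1 F
      · exact absurd ⟨fun F hF => (hd F hF).1, fun F hF => (hd F hF).2, hchain, hlt, hadd⟩ hN
      · push Not at hadd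
        obtain ⟨F, hF, G, hG, hGF, hle⟩ := hadd
        have hrk := rk_lt_of_ssubset M.1 (hd G hG).1 (hd F hF).1.subset_ground hGF
        set s := rk M.1 F - rk M.1 G with hs
        have hcle : Finsupp.single G 1 + Finsupp.single F s ≤ d := by
          intro H
          rw [Finsupp.add_apply, Finsupp.single_apply, Finsupp.single_apply]
          have hG0 : d G ≠ 0 := Finsupp.mem_support_iff.1 hG
          have hne : G ≠ F := hGF.ne
          split_ifs with h1 h2 h2
          · exact absurd (h1.trans h2.symm) hne
          · subst h1; omega
          · subst h2; omega
          · omega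
        obtain ⟨c, rfl⟩ := exists_add_of_le hcle
        have hc : ∀ H ∈ c.support, IsNonemptyFlat M H := fun H hH => hd H (by
          rw [Finsupp.mem_support_iff] at hH ⊢
          rw [Finsupp.add_apply]
          omega)
        have hrel := nef_mul_nef_pow M (hd G hG).1 (hd F hF).1 hGF.subset
        have e : nefMonomial M (Finsupp.single G 1 + Finsupp.single F s + c) =
            nefMonomial M (Finsupp.single F (s + 1) + c) := by
          simp only [nefMonomial_add, nefMonomial_single, pow_one]
          rw [hrel]
        rw [e]
        refine Submodule.subset_span ⟨_, ⟨hsupp (hsingle _ (hd F hF)) hc, ?_, ?_⟩, rfl⟩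
        · simp only [map_add, Finsupp.degree_single]
          omega
        · simp only [rankWeight_add, rankWeight_single]
          rw [add_mul, one_mul, one_mul]
          omega
    · push Not at hlt
      obtain ⟨F, hF, hle⟩ := hlt
      obtain ⟨c, rfl⟩ := exists_add_of_le
        (show Finsupp.single F (rk M.1 F) ≤ d from Finsupp.single_le_iff.2 hle)
      rw [nefMonomial_add, nefMonomial_single, nef_pow_rk M hL (hd F hF).1 (hd F hF).2, zero_mul]
      exact Submodule.zero_mem _
  · push Not at hchain
    obtain ⟨F, hF, G, hG, hFG, hGF⟩ := hchain
    have hne : F ≠ G := fun h => hFG h.subset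
    have hF0 : d F ≠ 0 := Finsupp.mem_support_iff.1 hF
    have hG0 : d G ≠ 0 := Finsupp.mem_support_iff.1 hG
    have hcle : Finsupp.single F 1 + Finsupp.single G 1 ≤ d := by
      intro H
      rw [Finsupp.add_apply, Finsupp.single_apply, Finsupp.single_apply]
      split_ifs with h1 h2 h2
      · exact absurd (h1.trans h2.symm) hne
      · subst h1; omega
      · subst h2; omega
      · omega
    obtain ⟨c, rfl⟩ := exists_add_of_le hcle
    have hc : ∀ H ∈ c.support, IsNonemptyFlat M H := fun H hH => hd H (by
      rw [Finsupp.mem_support_iff] at hH ⊢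
      rw [Finsupp.add_apply]
      omega)
    have hFGE : F ∪ G ⊆ M.1.E := union_subset (hd F hF).1.subset_ground (hd G hG).1.subset_ground
    set K := M.1.closure (F ∪ G) with hK
    have hsub : F ∪ G ⊆ K := M.1.subset_closure _ hFGE
    have hKf : IsNonemptyFlat M K :=
      ⟨M.1.isFlat_closure _, (hd F hF).2.mono (subset_union_left.trans hsub)⟩
    have hFK : rk M.1 F < rk M.1 K := rk_lt_of_ssubset M.1 (hd F hF).1 hKf.1.subset_ground
      ⟨subset_union_left.trans hsub, fun h => hGF (subset_union_right.trans (hsub.trans h))⟩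
    have hGK : rk M.1 G < rk M.1 K := rk_lt_of_ssubset M.1 (hd G hG).1 hKf.1.subset_ground
      ⟨subset_union_right.trans hsub, fun h => hFG (subset_union_left.trans (hsub.trans h))⟩
    have hrel := nef_sub_mul_nef_sub M F G
    rw [← nef_closure M hFGE, ← hK] at hrel
    have e : nefMonomial M (Finsupp.single F 1 + Finsupp.single G 1 + c) =
        nefMonomial M (Finsupp.single F 1 + Finsupp.single K 1 + c) +
          nefMonomial M (Finsupp.single G 1 + Finsupp.single K 1 + c) -
          nefMonomial M (Finsupp.single K 2 + c) := by
      simp only [nefMonomial_add, nefMonomial_single, pow_one]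
      linear_combination nefMonomial M c * hrel
    rw [e]
    refine Submodule.sub_mem _ (Submodule.add_mem _ ?_ ?_) ?_ <;>
      refine Submodule.subset_span ⟨_, ⟨hsupp ?_ hc, ?_, ?_⟩, rfl⟩
    · exact hsupp (hsingle _ (hd F hF)) (hsingle _ hKf)
    · simp only [map_add, Finsupp.degree_single]
    · simp only [rankWeight_add, rankWeight_single]
      omega
    · exact hsupp (hsingle _ (hd G hG)) (hsingle _ hKf)
    · simp only [map_add, Finsupp.degree_single]
    · simp only [rankWeight_add, rankWeight_single]
      omega
    · exact hsingle _ hKf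
    · simp only [map_add, Finsupp.degree_single]
    · simp only [rankWeight_add, rankWeight_single]
      omega

lemma nefMonomial_mem_span_normal (hL : M.1.Loopless) (j : ℕ) (d : Set ℕ+ →₀ ℕ)
    (hd : ∀ F ∈ d.support, IsNonemptyFlat M F) (hj : d.degree = j) :
    nefMonomial M d ∈ Submodule.span ℚ (nefMonomial M '' {e | IsNormal M.1 e ∧ e.degree = j}) := by
  obtain ⟨n, hn⟩ : ∃ n, j * rk M.1 M.1.E - rankWeight M.1 d = n := ⟨_, rfl⟩
  induction n using Nat.strong_induction_on generalizing d with
  | _ n ih =>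
    by_cases hN : IsNormal M.1 d
    · exact Submodule.subset_span ⟨d, ⟨hN, hj⟩, rfl⟩
    · refine Submodule.span_le.2 ?_ (exists_straightening M hL hd hN)
      rintro _ ⟨e, ⟨he, hdeg, hlt⟩, rfl⟩
      have hle := rankWeight_le M he
      rw [hdeg, hj] at hle
      exact ih _ (by omega) e he (hdeg.trans hj) rfl

lemma span_chowX_eq :
    Submodule.span ℚ (range (chowX M)) =
      Submodule.span ℚ (nef M '' {F | IsNonemptyFlat M F}) := by
  classical
  apply le_antisymm
  · rw [Submodule.span_le]
    rintro _ ⟨F, rfl⟩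
    rw [SetLike.mem_coe]
    induction F using WellFoundedGT.induction with
    | ind F ih =>
      have hF : IsNonemptyFlat M F.1 := ⟨F.2.1, nonempty_iff_ne_empty.2 F.2.2.1⟩
      have hE : IsNonemptyFlat M M.1.E := ⟨M.1.ground_isFlat, hF.2.mono hF.1.subset_ground⟩
      have h1 : nef M F.1 - nef M M.1.E = ∑ G : ProperFlat M with F.1 ⊆ G.1, chowX M G := by
        rw [nef, nef, sub_sub_sub_cancel_right, sub_eq_self]
        refine Finset.sum_eq_zero fun G hG => absurd ?_ G.2.2.2
        exact subset_antisymm G.2.1.subset_ground (Finset.mem_filter.1 hG).2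
      rw [← Finset.sum_erase_add _ _ (a := F) (by simp)] at h1
      rw [← sub_eq_iff_eq_add'.2 h1]
      refine Submodule.sub_mem _ (Submodule.sub_mem _ (Submodule.subset_span ⟨_, hF, rfl⟩)
        (Submodule.subset_span ⟨_, hE, rfl⟩)) (Submodule.sum_mem _ fun G hG => ih G ?_)
      rw [Finset.mem_erase, Finset.mem_filter] at hG
      exact lt_of_le_of_ne hG.2.2 (Ne.symm hG.1)
  · rw [Submodule.span_le]
    rintro _ ⟨A, hA, rfl⟩
    obtain ⟨i, hi⟩ := hA.2
    rw [nef, chowAlpha_eq M (hA.1.subset_ground hi)]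
    exact Submodule.sub_mem _ (Submodule.sum_mem _ fun F _ => Submodule.subset_span ⟨F, rfl⟩)
      (Submodule.sum_mem _ fun F _ => Submodule.subset_span ⟨F, rfl⟩)

lemma chowGraded_eq_pow (j : ℕ) :
    chowGraded M j = Submodule.span ℚ (nef M '' {F | IsNonemptyFlat M F}) ^ j := by
  rw [chowGraded, ← MvPolynomial.homogeneousSubmodule_one_pow, Submodule.map_pow,
    MvPolynomial.homogeneousSubmodule_one_eq_span_X, Submodule.map_span, ← range_comp,
    ← span_chowX_eq]
  rfl

/-- The normal monomials of degree `j` span the graded piece of degree `j`. -/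
lemma chowGraded_eq_span (hL : M.1.Loopless) (j : ℕ) :
    chowGraded M j =
      Submodule.span ℚ (nefMonomial M '' {e | IsNormal M.1 e ∧ e.degree = j}) := by
  classical
  rw [chowGraded_eq_pow]
  apply le_antisymm
  · have h : Submodule.span ℚ (nef M '' {F | IsNonemptyFlat M F}) ^ j ≤ Submodule.span ℚ
        (nefMonomial M '' {e | (∀ F ∈ e.support, IsNonemptyFlat M F) ∧ e.degree = j}) := by
      induction j with
      | zero =>
        rw [pow_zero, Submodule.one_le]
        exact Submodule.subset_span ⟨0, by simp, Finsupp.prod_zero_index⟩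
      | succ j ih =>
        rw [pow_succ]
        refine (mul_le_mul' ih le_rfl).trans ?_
        rw [Submodule.span_mul_span]
        apply Submodule.span_mono
        rintro _ ⟨_, ⟨d, ⟨hd, hj⟩, rfl⟩, _, ⟨F, hF, rfl⟩, rfl⟩
        refine ⟨d + Finsupp.single F 1, ⟨fun G hG => ?_, ?_⟩, ?_⟩
        · rcases Finset.mem_union.1 (Finsupp.support_add hG) with h | h
          · exact hd G h
          · rw [Finset.mem_singleton.1 (Finsupp.support_single_subset h)]
            exact hF
        · rw [map_add, hj, Finsupp.degree_single]
        · rw [nefMonomial_add, nefMonomial_single, pow_one]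
    refine h.trans (Submodule.span_le.2 ?_)
    rintro _ ⟨d, ⟨hd, hj⟩, rfl⟩
    exact nefMonomial_mem_span_normal M hL j d hd hj
  · rw [Submodule.span_le]
    rintro _ ⟨d, ⟨hd, rfl⟩, rfl⟩
    have hmem : ∀ e : Set ℕ+ →₀ ℕ, (∀ F ∈ e.support, IsNonemptyFlat M F) →
        nefMonomial M e ∈ Submodule.span ℚ (nef M '' {F | IsNonemptyFlat M F}) ^ e.degree := by
      intro e
      induction e using Finsupp.induction with
      | zero =>
        intro _
        rw [map_zero, pow_zero]
        exact Submodule.one_le.1 le_rfl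
      | single_add F k e hF hk ih =>
        intro he
        rw [map_add, pow_add, nefMonomial_add, nefMonomial_single, Finsupp.degree_single]
        have hF' : IsNonemptyFlat M F := he F (by
          rw [Finsupp.mem_support_iff, Finsupp.add_apply, Finsupp.single_eq_same]
          omega)
        have h1 := Submodule.subset_span (R := ℚ) (mem_image_of_mem (nef M)
          (show F ∈ {F | IsNonemptyFlat M F} from hF'))
        refine Submodule.mul_mem_mul (Submodule.pow_mem_pow _ h1 k) (ih fun G hG => he G ?_)
        · rw [Finsupp.mem_support_iff] at hG ⊢
          rw [Finsupp.add_apply]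
          omega
    exact hmem d fun F hF => ⟨hd.isFlat F hF, hd.rankNormal.nonempty F hF⟩

end Nef

/-! ### The strata of a chain of flats and the dragon marriage condition -/

section Dragon

/-- The union of the sets of the support of `d` that are strictly contained in `P`: for a chain,
the predecessor of `P`, or the empty set. -/
def chainBase (d : Set ℕ+ →₀ ℕ) (P : Set ℕ+) : Set ℕ+ := ⋃₀ {G | G ∈ d.support ∧ G ⊂ P}

/-- The set `A` is contained in `P` but not in the predecessor of `P`. -/
def InStratum (d : Set ℕ+ →₀ ℕ) (P A : Set ℕ+) : Prop := A ⊆ P ∧ ¬ A ⊆ chainBase d P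

/-- The dragon marriage condition at `P`, for the interval between the predecessor of `P` and `P`:
any subfamily, taken with multiplicities `m`, of sets in the stratum of `P` has relative rank
greater than its cardinality. -/
def Dragon (M : Matroid ℕ+) (d : Set ℕ+ →₀ ℕ) (P : Set ℕ+) (m : Set ℕ+ →₀ ℕ) : Prop :=
  ∀ S : Finset (Set ℕ+), (∀ A ∈ S, InStratum d P A) → 0 < ∑ A ∈ S, m A →
    rk M (chainBase d P) + ∑ A ∈ S, m A + 1 ≤ rk M (chainBase d P ∪ ⋃₀ ↑S)

open Classical in
/-- The total multiplicity of the sets in the stratum of `P`. -/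
noncomputable def stratumMass (d : Set ℕ+ →₀ ℕ) (P : Set ℕ+) (m : Set ℕ+ →₀ ℕ) : ℕ :=
  m.sum fun A k => if InStratum d P A then k else 0

/-- The exponent `m` pairs to one with the normal exponent `d`: its sets are distributed over the
strata of the support of `d` with the multiplicities given by `d`, and satisfy the dragon marriage
condition in each stratum. -/
structure IsMatched (M : Matroid ℕ+) (d m : Set ℕ+ →₀ ℕ) : Prop where
  covered : ∀ A ∈ m.support, ∃ P ∈ d.support, A ⊆ P
  mass : ∀ P ∈ d.support, stratumMass d P m = d P
  dragon : ∀ P ∈ d.support, Dragon M d P m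

variable {M : Matroid ℕ+} {d m n : Set ℕ+ →₀ ℕ} {P A B F G K : Set ℕ+}

lemma stratumMass_add (d : Set ℕ+ →₀ ℕ) (P : Set ℕ+) (m n : Set ℕ+ →₀ ℕ) :
    stratumMass d P (m + n) = stratumMass d P m + stratumMass d P n :=
  Finsupp.sum_add_index' (fun _ => ite_self _) fun A b₁ b₂ => by split_ifs <;> simp

open Classical in
lemma stratumMass_single (d : Set ℕ+ →₀ ℕ) (P A : Set ℕ+) :
    stratumMass d P (Finsupp.single A 1) = if InStratum d P A then 1 else 0 :=
  Finsupp.sum_single_index (ite_self _)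

open Classical in
lemma sum_add_single (S : Finset (Set ℕ+)) (n : Set ℕ+ →₀ ℕ) (A : Set ℕ+) :
    ∑ B ∈ S, (n + Finsupp.single A 1 : Set ℕ+ →₀ ℕ) B = ∑ B ∈ S, n B + if A ∈ S then 1 else 0 := by
  simp [Finset.sum_add_distrib, Finsupp.single_apply]

lemma mem_support_add_single :
    B ∈ (n + Finsupp.single A 1).support ↔ B ∈ n.support ∨ B = A := by
  classical
  rw [Finsupp.mem_support_iff, Finsupp.mem_support_iff, Finsupp.add_apply, Finsupp.single_apply]
  by_cases h : A = B
  · simp [h]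
  · simp [h, Ne.symm h]

lemma chainBase_subset : chainBase d P ⊆ P := sUnion_subset fun _ hG => hG.2.subset

lemma subset_chainBase (hG : G ∈ d.support) (h : G ⊂ P) : G ⊆ chainBase d P :=
  subset_sUnion_of_mem ⟨hG, h⟩

lemma chainBase_eq (hC : ∀ F ∈ d.support, ∀ G ∈ d.support, F ⊆ G ∨ G ⊆ F) (P : Set ℕ+) :
    chainBase d P = ∅ ∨ chainBase d P ∈ d.support ∧ chainBase d P ⊂ P := by
  classical
  by_cases hne : (d.support.filter (· ⊂ P)).Nonempty
  · obtain ⟨G, hG⟩ := Finset.exists_maximal hne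
    have hG' := Finset.mem_filter.1 hG.1
    have : chainBase d P = G := by
      refine subset_antisymm (sUnion_subset ?_) (subset_chainBase hG'.1 hG'.2)
      rintro H ⟨hH, hHP⟩
      rcases hC H hH G hG'.1 with h | h
      · exact h
      · exact hG.2 (Finset.mem_filter.2 ⟨hH, hHP⟩) h
    rw [this]
    exact Or.inr hG'
  · left
    rw [Finset.not_nonempty_iff_eq_empty, Finset.filter_eq_empty_iff] at hne
    rw [chainBase, sUnion_eq_empty]
    rintro G ⟨hG, hGP⟩
    exact absurd hGP (hne hG)

lemma exists_inStratum (hC : ∀ F ∈ d.support, ∀ G ∈ d.support, F ⊆ G ∨ G ⊆ F)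
    (hA : A.Nonempty) (h : ∃ P ∈ d.support, A ⊆ P) : ∃ P ∈ d.support, InStratum d P A := by
  classical
  obtain ⟨P₀, hP₀, hAP₀⟩ := h
  obtain ⟨P, hP⟩ := Finset.exists_minimal
    (⟨P₀, Finset.mem_filter.2 ⟨hP₀, hAP₀⟩⟩ : (d.support.filter (A ⊆ ·)).Nonempty)
  have hP' := Finset.mem_filter.1 hP.1
  refine ⟨P, hP'.1, hP'.2, fun hle => ?_⟩
  rcases chainBase_eq hC P with h | ⟨h1, h2⟩
  · rw [h] at hle
    exact hA.ne_empty (subset_empty_iff.1 hle)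
  · exact h2.not_subset (hP.2 (Finset.mem_filter.2 ⟨h1, hle⟩) h2.subset)

lemma InStratum.unique (hC : ∀ F ∈ d.support, ∀ G ∈ d.support, F ⊆ G ∨ G ⊆ F)
    {P P' : Set ℕ+} (hP : P ∈ d.support) (hP' : P' ∈ d.support)
    (h : InStratum d P A) (h' : InStratum d P' A) : P = P' := by
  by_contra hne
  rcases hC P hP P' hP' with hs | hs
  · exact h'.2 (h.1.trans (subset_chainBase hP (hs.ssubset_of_ne hne)))
  · exact h.2 (h'.1.trans (subset_chainBase hP' (hs.ssubset_of_ne (Ne.symm hne))))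

lemma Dragon.mono (h : Dragon M d P n) (hle : m ≤ n) : Dragon M d P m := by
  intro S hS hpos
  have h1 : ∑ A ∈ S, m A ≤ ∑ A ∈ S, n A := Finset.sum_le_sum fun A _ => hle A
  have := h S hS (hpos.trans_le h1)
  omega

/-- At a stratum not containing `A`, the multiplicity of `A` does not matter. -/
lemma dragon_add_single_iff (hA : ¬ InStratum d P A) :
    Dragon M d P (n + Finsupp.single A 1) ↔ Dragon M d P n := by
  classical
  refine forall_congr' fun S => forall_congr' fun hS => ?_
  rw [sum_add_single, if_neg fun h => hA (hS A h), add_zero]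

lemma rk_insert_of_subset {S : Finset (Set ℕ+)} [DecidableEq (Set ℕ+)]
    (h : ∃ K ∈ S, G ⊆ K) (X : Set ℕ+) :
    rk M (X ∪ ⋃₀ ↑(insert G S)) = rk M (X ∪ ⋃₀ ↑S) := by
  obtain ⟨K, hK, hGK⟩ := h
  rw [Finset.coe_insert, sUnion_insert, union_eq_self_of_subset_left
    (hGK.trans (subset_sUnion_of_mem (Finset.mem_coe.2 hK)) : G ⊆ ⋃₀ ↑S)]

lemma rk_insert_of_subset_closure [M.RankFinite] {S : Finset (Set ℕ+)} [DecidableEq (Set ℕ+)]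
    {X : Set ℕ+} (hXE : X ∪ ⋃₀ ↑S ⊆ M.E) (h : K ⊆ M.closure (X ∪ ⋃₀ ↑S)) :
    rk M (X ∪ ⋃₀ ↑(insert K S)) = rk M (X ∪ ⋃₀ ↑S) := by
  rw [Finset.coe_insert, sUnion_insert]
  refine rk_eq_of_subset_closure M ?_ ?_
  · exact union_subset_union_right _ subset_union_right
  · exact union_subset (subset_union_left.trans (M.subset_closure _ hXE))
      (union_subset h (subset_union_right.trans (M.subset_closure _ hXE)))

/-- Replacing a set of the stratum by a larger one preserves the dragon marriage condition. -/
lemma Dragon.replace_of_subset (hG : InStratum d P G) (hGK : G ⊆ K)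
    (h : Dragon M d P (n + Finsupp.single G 1)) : Dragon M d P (n + Finsupp.single K 1) := by
  classical
  intro S hS hpos
  rw [sum_add_single] at hpos ⊢
  by_cases hKS : K ∈ S
  · have h1 := h (insert G S) (Finset.forall_mem_insert _ _ _ |>.2 ⟨hG, hS⟩)
    rw [sum_add_single, if_pos (Finset.mem_insert_self _ _), rk_insert_of_subset ⟨K, hKS, hGK⟩] at h1
    have h2 : ∑ B ∈ S, n B ≤ ∑ B ∈ insert G S, n B :=
      Finset.sum_le_sum_of_subset (Finset.subset_insert _ _)
    rw [if_pos hKS]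
    have := h1 (by omega)
    omega
  · rw [if_neg hKS] at hpos ⊢
    have h1 := h S hS
    rw [sum_add_single] at h1
    have := h1 (by omega)
    omega

lemma sUnion_subset_ground {S : Finset (Set ℕ+)} (hP : P ⊆ M.E) (hS : ∀ A ∈ S, InStratum d P A) :
    chainBase d P ∪ ⋃₀ ↑S ⊆ M.E :=
  (union_subset chainBase_subset (sUnion_subset fun A hA => (hS A hA).1)).trans hP

variable [M.RankFinite]

/-- Replacing a set of the stratum by a smaller one with the same closure over the predecessor of
`P` preserves the dragon marriage condition. -/
lemma Dragon.replace_of_subset_closure (hPE : P ⊆ M.E) (hK : InStratum d P K)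
    (hKG : K ⊆ M.closure (chainBase d P ∪ G))
    (h : Dragon M d P (n + Finsupp.single K 1)) : Dragon M d P (n + Finsupp.single G 1) := by
  classical
  intro S hS hpos
  rw [sum_add_single] at hpos ⊢
  by_cases hGS : G ∈ S
  · have h1 := h (insert K S) (Finset.forall_mem_insert _ _ _ |>.2 ⟨hK, hS⟩)
    have h3 : K ⊆ M.closure (chainBase d P ∪ ⋃₀ ↑S) := hKG.trans (M.closure_subset_closure
      (union_subset_union_right _ (subset_sUnion_of_mem (Finset.mem_coe.2 hGS))))
    rw [sum_add_single, if_pos (Finset.mem_insert_self _ _),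
      rk_insert_of_subset_closure (sUnion_subset_ground hPE hS) h3] at h1
    have h2 : ∑ B ∈ S, n B ≤ ∑ B ∈ insert K S, n B :=
      Finset.sum_le_sum_of_subset (Finset.subset_insert _ _)
    rw [if_pos hGS]
    have := h1 (by omega)
    omega
  · rw [if_neg hGS] at hpos ⊢
    have h1 := h S hS
    rw [sum_add_single] at h1
    have := h1 (by omega)
    omega

omit [M.RankFinite] in
/-- A set `F` of the stratum and a larger set `K` satisfy the condition jointly if `F` can be
added and `K` can be added twice. -/
lemma dragon_add_add_iff (hF : InStratum d P F) (hFK : F ⊆ K) :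
    Dragon M d P (n + Finsupp.single F 1 + Finsupp.single K 1) ↔
      Dragon M d P (n + Finsupp.single F 1) ∧
        Dragon M d P (n + Finsupp.single K 1 + Finsupp.single K 1) := by
  classical
  constructor
  · intro h
    refine ⟨h.mono le_self_add, Dragon.replace_of_subset hF hFK ?_⟩
    rwa [add_right_comm]
  · rintro ⟨h1, h2⟩ S hS hpos
    have h1 := h1 S hS
    have h2 := h2 S hS
    simp only [sum_add_single] at *
    by_cases hKS : K ∈ S
    · rw [if_pos hKS] at *
      have := h2 (by omega)
      split_ifs <;> omega
    · rw [if_neg hKS] at *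
      exact h1 hpos

/-- Two sets `F`, `G` of the stratum satisfy the condition jointly if each does and their join
`K` can be added twice. -/
lemma dragon_add_add_iff_join (hPE : P ⊆ M.E) (hF : InStratum d P F) (hG : InStratum d P G)
    (hK : InStratum d P K) (hFK : F ⊆ K) (hGK : G ⊆ K) (hcl : K ⊆ M.closure (F ∪ G)) :
    Dragon M d P (n + Finsupp.single F 1 + Finsupp.single G 1) ↔
      Dragon M d P (n + Finsupp.single F 1) ∧ Dragon M d P (n + Finsupp.single G 1) ∧
        Dragon M d P (n + Finsupp.single K 1 + Finsupp.single K 1) := by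
  classical
  constructor
  · intro h
    refine ⟨h.mono le_self_add, ?_, ?_⟩
    · rw [add_right_comm] at h
      exact h.mono le_self_add
    · refine Dragon.replace_of_subset hF hFK ?_
      rw [add_right_comm]
      exact Dragon.replace_of_subset hG hGK h
  · rintro ⟨h1, h2, h3⟩ S hS hpos
    have h1 := h1 S hS
    have h2 := h2 S hS
    have h3 := h3 (insert K S) (Finset.forall_mem_insert _ _ _ |>.2 ⟨hK, hS⟩)
    simp only [sum_add_single] at *
    rw [if_pos (Finset.mem_insert_self _ _)] at h3
    have hle : ∑ B ∈ S, n B ≤ ∑ B ∈ insert K S, n B :=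
      Finset.sum_le_sum_of_subset (Finset.subset_insert _ _)
    by_cases hFS : F ∈ S
    · by_cases hGS : G ∈ S
      · rw [rk_insert_of_subset_closure (sUnion_subset_ground hPE hS)] at h3
        · rw [if_pos hFS, if_pos hGS]
          have := h3 (by omega)
          omega
        · refine hcl.trans (M.closure_subset_closure ?_)
          exact union_subset
            ((subset_sUnion_of_mem (Finset.mem_coe.2 hFS)).trans subset_union_right)
            ((subset_sUnion_of_mem (Finset.mem_coe.2 hGS)).trans subset_union_right)
      · rw [if_neg hGS] at *
        exact h1 hpos
    · rw [if_neg hFS] at *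
      exact h2 hpos

/-- If neither `F` nor `G` can be added, their join `K` cannot be added twice. A violating family
for `F` and one for `G` have, by submodularity of the rank, a violating union. -/
lemma not_dragon_join (hPE : P ⊆ M.E) (hK : InStratum d P K) (hcl : K ⊆ M.closure (F ∪ G))
    (hF : ¬ Dragon M d P (n + Finsupp.single F 1)) (hG : ¬ Dragon M d P (n + Finsupp.single G 1)) :
    ¬ Dragon M d P (n + Finsupp.single K 1 + Finsupp.single K 1) := by
  classical
  intro h
  have h0 : Dragon M d P n := h.mono (le_self_add.trans le_self_add)
  have key : ∀ H : Set ℕ+, ¬ Dragon M d P (n + Finsupp.single H 1) →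
      ∃ S : Finset (Set ℕ+), (∀ A ∈ S, InStratum d P A) ∧ H ∈ S ∧
        rk M (chainBase d P ∪ ⋃₀ ↑S) ≤ rk M (chainBase d P) + ∑ A ∈ S, n A + 1 := by
    intro H hH
    rw [Dragon] at hH
    push Not at hH
    obtain ⟨S, hS, hpos, hlt⟩ := hH
    rw [sum_add_single] at hpos hlt
    have hHS : H ∈ S := by
      by_contra hHS
      rw [if_neg hHS] at hpos hlt
      have := h0 S hS hpos
      omega
    rw [if_pos hHS] at hlt
    exact ⟨S, hS, hHS, by omega⟩
  obtain ⟨S, hS, hFS, hSle⟩ := key F hF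
  obtain ⟨T, hT, hGT, hTle⟩ := key G hG
  have hU : ∀ A ∈ S ∪ T, InStratum d P A := fun A hA =>
    (Finset.mem_union.1 hA).elim (hS A) (hT A)
  have hsub := rk_inter_add_rk_union_le M (chainBase d P ∪ ⋃₀ ↑S) (chainBase d P ∪ ⋃₀ ↑T)
  have hun : (chainBase d P ∪ ⋃₀ ↑S) ∪ (chainBase d P ∪ ⋃₀ ↑T) =
      chainBase d P ∪ ⋃₀ (↑(S ∪ T) : Set (Set ℕ+)) := by
    rw [Finset.coe_union, sUnion_union, ← union_union_distrib_left]
  have hint : chainBase d P ∪ ⋃₀ (↑(S ∩ T) : Set (Set ℕ+)) ⊆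
      (chainBase d P ∪ ⋃₀ ↑S) ∩ (chainBase d P ∪ ⋃₀ ↑T) := by
    rw [Finset.coe_inter]
    exact subset_inter
      (union_subset_union_right _ (sUnion_subset_sUnion inter_subset_left))
      (union_subset_union_right _ (sUnion_subset_sUnion inter_subset_right))
  have h1 : rk M (chainBase d P) + ∑ A ∈ S ∩ T, n A ≤
      rk M (chainBase d P ∪ ⋃₀ (↑(S ∩ T) : Set (Set ℕ+))) := by
    rcases Nat.eq_zero_or_pos (∑ A ∈ S ∩ T, n A) with hz | hz
    · rw [hz, add_zero]
      exact rk_mono M subset_union_left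
    · have := h0 (S ∩ T) (fun A hA => hS A (Finset.mem_inter.1 hA).1) hz
      omega
  have h2 := h1.trans (rk_mono M hint)
  have h3 := h (insert K (S ∪ T)) (Finset.forall_mem_insert _ _ _ |>.2 ⟨hK, hU⟩)
  rw [rk_insert_of_subset_closure (sUnion_subset_ground hPE hU)] at h3
  · rw [sum_add_single, sum_add_single, if_pos (Finset.mem_insert_self _ _)] at h3
    have h4 : ∑ A ∈ S ∪ T, n A ≤ ∑ A ∈ insert K (S ∪ T), n A :=
      Finset.sum_le_sum_of_subset (Finset.subset_insert _ _)
    have h5 := Finset.sum_union_inter (s₁ := S) (s₂ := T) (f := n)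
    have h6 := h3 (by omega)
    rw [hun] at hsub
    omega
  · refine hcl.trans (M.closure_subset_closure ?_)
    exact union_subset
      ((subset_sUnion_of_mem (by simp [hFS])).trans subset_union_right)
      ((subset_sUnion_of_mem (by simp [hGT])).trans subset_union_right)

end Dragon

/-! ### Matched exponents -/

section Matched

variable {M : Matroid ℕ+} {d m n : Set ℕ+ →₀ ℕ} {P A B F G K : Set ℕ+}

lemma not_isMatched_of_not_covered (hA : ¬ ∃ P ∈ d.support, A ⊆ P) :
    ¬ IsMatched M d (n + Finsupp.single A 1) := fun h =>
  hA (h.covered A (mem_support_add_single.2 (Or.inr rfl)))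

/-- The part of the condition of being matched that is the same for all exponents obtained from
`n` by adding two sets of the stratum of `P`. -/
structure IsMatchedAway (M : Matroid ℕ+) (d : Set ℕ+ →₀ ℕ) (P : Set ℕ+) (n : Set ℕ+ →₀ ℕ) :
    Prop where
  covered : ∀ A ∈ n.support, ∃ Q ∈ d.support, A ⊆ Q
  mass : ∀ Q ∈ d.support, Q ≠ P → stratumMass d Q n = d Q
  mass_self : stratumMass d P n + 2 = d P
  dragon : ∀ Q ∈ d.support, Q ≠ P → Dragon M d Q n

lemma isMatched_add_add_iff (hC : ∀ F ∈ d.support, ∀ G ∈ d.support, F ⊆ G ∨ G ⊆ F)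
    (hP : P ∈ d.support) (hA : InStratum d P A) (hB : InStratum d P B) :
    IsMatched M d (n + Finsupp.single A 1 + Finsupp.single B 1) ↔
      IsMatchedAway M d P n ∧ Dragon M d P (n + Finsupp.single A 1 + Finsupp.single B 1) := by
  have hA' : ∀ Q ∈ d.support, Q ≠ P → ¬ InStratum d Q A := fun Q hQ hne h =>
    hne (h.unique hC hQ hP hA)
  have hB' : ∀ Q ∈ d.support, Q ≠ P → ¬ InStratum d Q B := fun Q hQ hne h =>
    hne (h.unique hC hQ hP hB)
  have hmass : ∀ Q ∈ d.support, Q ≠ P →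
      stratumMass d Q (n + Finsupp.single A 1 + Finsupp.single B 1) = stratumMass d Q n :=
    fun Q hQ hne => by
      rw [stratumMass_add, stratumMass_add, stratumMass_single, stratumMass_single,
        if_neg (hA' Q hQ hne), if_neg (hB' Q hQ hne), add_zero, add_zero]
  have hmassP : stratumMass d P (n + Finsupp.single A 1 + Finsupp.single B 1) =
      stratumMass d P n + 2 := by
    rw [stratumMass_add, stratumMass_add, stratumMass_single, stratumMass_single, if_pos hA,
      if_pos hB]
  have hdragon : ∀ Q ∈ d.support, Q ≠ P →
      (Dragon M d Q (n + Finsupp.single A 1 + Finsupp.single B 1) ↔ Dragon M d Q n) :=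
    fun Q hQ hne => by
      rw [dragon_add_single_iff (hB' Q hQ hne), dragon_add_single_iff (hA' Q hQ hne)]
  constructor
  · intro h
    refine ⟨⟨fun C hC => ?_, fun Q hQ hne => ?_, ?_, fun Q hQ hne => ?_⟩, h.dragon P hP⟩
    · exact h.covered C (mem_support_add_single.2 (Or.inl (mem_support_add_single.2 (Or.inl hC))))
    · rw [← hmass Q hQ hne, h.mass Q hQ]
    · rw [← hmassP, h.mass P hP]
    · exact (hdragon Q hQ hne).1 (h.dragon Q hQ)
  · rintro ⟨h, hD⟩
    refine ⟨fun C hC => ?_, fun Q hQ => ?_, fun Q hQ => ?_⟩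
    · rcases mem_support_add_single.1 hC with hC | rfl
      · rcases mem_support_add_single.1 hC with hC | rfl
        · exact h.covered C hC
        · exact ⟨P, hP, hA.1⟩
      · exact ⟨P, hP, hB.1⟩
    · by_cases hne : Q = P
      · rw [hne, hmassP, h.mass_self]
      · rw [hmass Q hQ hne, h.mass Q hQ hne]
    · by_cases hne : Q = P
      · rwa [hne]
      · exact (hdragon Q hQ hne).2 (h.dragon Q hQ hne)

variable [M.RankFinite]

/-- Replacing a set by a larger one of the same stratum, with the same closure over the predecessor
of `P`, does not affect whether an exponent is matched. -/
lemma isMatched_add_single_iff (hC : ∀ F ∈ d.support, ∀ G ∈ d.support, F ⊆ G ∨ G ⊆ F)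
    (hP : P ∈ d.support) (hPE : P ⊆ M.E) (hG : InStratum d P G) (hK : InStratum d P K)
    (hGK : G ⊆ K) (hKG : K ⊆ M.closure (chainBase d P ∪ G)) :
    IsMatched M d (n + Finsupp.single G 1) ↔ IsMatched M d (n + Finsupp.single K 1) := by
  classical
  -- Both directions preserve covering and masses; only the condition at `P` differs.
  have aux : ∀ A B : Set ℕ+, InStratum d P A → InStratum d P B →
      (Dragon M d P (n + Finsupp.single A 1) → Dragon M d P (n + Finsupp.single B 1)) →
      IsMatched M d (n + Finsupp.single A 1) → IsMatched M d (n + Finsupp.single B 1) := by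
    intro A B hA hB hD h
    have hiff : ∀ Q ∈ d.support, InStratum d Q A ↔ InStratum d Q B := fun Q hQ =>
      ⟨fun h => by rwa [h.unique hC hQ hP hA], fun h => by rwa [h.unique hC hQ hP hB]⟩
    refine ⟨fun C hC => ?_, fun Q hQ => ?_, fun Q hQ => ?_⟩
    · rcases mem_support_add_single.1 hC with hC | rfl
      · exact h.covered C (mem_support_add_single.2 (Or.inl hC))
      · exact ⟨P, hP, hB.1⟩
    · rw [← h.mass Q hQ, stratumMass_add, stratumMass_add, stratumMass_single, stratumMass_single]
      exact congrArg _ (if_congr (hiff Q hQ).symm rfl rfl)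
    · by_cases hQA : InStratum d Q A
      · have hQP := hQA.unique hC hQ hP hA
        subst hQP
        exact hD (h.dragon Q hQ)
      · have h1 := h.dragon Q hQ
        rw [dragon_add_single_iff hQA] at h1
        rwa [dragon_add_single_iff fun h => hQA ((hiff Q hQ).2 h)]
  exact ⟨aux G K hG hK fun h => h.replace_of_subset hG hGK,
    aux K G hK hG fun h => h.replace_of_subset_closure hPE hK hKG⟩

open Classical in
/-- The indicator of being matched, as a rational number. -/
noncomputable def matchCoeff (M : Matroid ℕ+) (d m : Set ℕ+ →₀ ℕ) : ℚ :=
  if IsMatched M d m then 1 else 0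

/-- The indicator of being matched with a normal exponent satisfies the quadratic relations of the
Chow ring. -/
lemma matchCoeff_quadratic (hd : IsNormal M d) (hF : M.IsFlat F) (hFne : F.Nonempty)
    (hG : M.IsFlat G) (hGne : G.Nonempty) (n : Set ℕ+ →₀ ℕ) :
    matchCoeff M d (n + Finsupp.single F 1 + Finsupp.single G 1) -
      matchCoeff M d (n + Finsupp.single F 1 + Finsupp.single (M.closure (F ∪ G)) 1) -
      matchCoeff M d (n + Finsupp.single G 1 + Finsupp.single (M.closure (F ∪ G)) 1) +
      matchCoeff M d (n + Finsupp.single (M.closure (F ∪ G)) 1 +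
        Finsupp.single (M.closure (F ∪ G)) 1) = 0 := by
  classical
  set K := M.closure (F ∪ G) with hK
  have hC := hd.rankNormal.chain
  have hFGK : F ∪ G ⊆ K := M.subset_closure _ (union_subset hF.subset_ground hG.subset_ground)
  have hFK : F ⊆ K := subset_union_left.trans hFGK
  have hGK : G ⊆ K := subset_union_right.trans hFGK
  have hKsub : ∀ P ∈ d.support, F ⊆ P → G ⊆ P → K ⊆ P := fun P hP h1 h2 => by
    rw [← (hd.isFlat P hP).closure]
    exact M.closure_subset_closure (union_subset h1 h2)
  -- If `F` lies in a lower stratum than `G`, then `G` and `K` are interchangeable.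
  have lower : ∀ F G : Set ℕ+, G ⊆ K → K ⊆ M.closure (F ∪ G) → (∀ P ∈ d.support, F ⊆ P → G ⊆ P →
      K ⊆ P) → ∀ P ∈ d.support, ∀ Q ∈ d.support, P ⊂ Q → InStratum d P F → InStratum d Q G →
      ∀ c, matchCoeff M d (c + Finsupp.single G 1) = matchCoeff M d (c + Finsupp.single K 1) := by
    intro F G hGK hKcl hKsub P hP Q hQ hPQ hFP hGQ c
    have h1 : F ⊆ chainBase d Q := hFP.1.trans (subset_chainBase hP hPQ)
    have hKQ : InStratum d Q K := ⟨hKsub Q hQ (hFP.1.trans hPQ.subset) hGQ.1,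
      fun h => hGQ.2 (hGK.trans h)⟩
    have := isMatched_add_single_iff (n := c) hC hQ (hd.isFlat Q hQ).subset_ground hGQ hKQ hGK
      (hKcl.trans (M.closure_subset_closure (union_subset_union_left _ h1)))
    exact if_congr this rfl rfl
  by_cases hFc : ∃ P ∈ d.support, F ⊆ P
  swap
  · have hKc : ¬ ∃ P ∈ d.support, K ⊆ P := fun ⟨P, hP, h⟩ => hFc ⟨P, hP, hFK.trans h⟩
    have e : n + Finsupp.single F 1 + Finsupp.single G 1 =
      n + Finsupp.single G 1 + Finsupp.single F 1 := add_right_comm _ _ _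
    simp only [matchCoeff, e, not_isMatched_of_not_covered hFc, not_isMatched_of_not_covered hKc,
      if_false]
    norm_num
  by_cases hGc : ∃ P ∈ d.support, G ⊆ P
  swap
  · have hKc : ¬ ∃ P ∈ d.support, K ⊆ P := fun ⟨P, hP, h⟩ => hGc ⟨P, hP, hGK.trans h⟩
    simp only [matchCoeff, not_isMatched_of_not_covered hGc, not_isMatched_of_not_covered hKc,
      if_false]
    norm_num
  obtain ⟨P, hP, hFP⟩ := exists_inStratum hC hFne hFc
  obtain ⟨Q, hQ, hGQ⟩ := exists_inStratum hC hGne hGc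
  by_cases hPQ : P = Q
  · subst hPQ
    have hKP : InStratum d P K := ⟨hKsub P hP hFP.1 hGQ.1, fun h => hFP.2 (hFK.trans h)⟩
    have hPE := (hd.isFlat P hP).subset_ground
    have h1 := dragon_add_add_iff_join (n := n) hPE hFP hGQ hKP hFK hGK subset_rfl
    have h2 := dragon_add_add_iff (M := M) (n := n) hFP hFK
    have h3 := dragon_add_add_iff (M := M) (n := n) hGQ hGK
    have h4 := not_dragon_join (n := n) hPE hKP (subset_rfl : K ⊆ M.closure (F ∪ G))
    have e1 := (isMatched_add_add_iff (M := M) (n := n) hC hP hFP hGQ).trans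
      (and_congr_right fun _ => h1)
    have e2 := (isMatched_add_add_iff (M := M) (n := n) hC hP hFP hKP).trans
      (and_congr_right fun _ => h2)
    have e3 := (isMatched_add_add_iff (M := M) (n := n) hC hP hGQ hKP).trans
      (and_congr_right fun _ => h3)
    have e4 := isMatched_add_add_iff (M := M) (n := n) hC hP hKP hKP
    rw [matchCoeff, matchCoeff, matchCoeff, matchCoeff, if_congr e1 rfl rfl, if_congr e2 rfl rfl,
      if_congr e3 rfl rfl, if_congr e4 rfl rfl]
    by_cases ha : Dragon M d P (n + Finsupp.single F 1) <;>
      by_cases hb : Dragon M d P (n + Finsupp.single G 1)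
    · simp [ha, hb]
    · simp [ha, hb]
    · simp [ha, hb]
    · simp [ha, hb, h4 ha hb]
  · rcases hC P hP Q hQ with h | h
    · have key := lower F G hGK subset_rfl hKsub P hP Q hQ (h.ssubset_of_ne hPQ) hFP hGQ
      have e : n + Finsupp.single G 1 + Finsupp.single K 1 =
        n + Finsupp.single K 1 + Finsupp.single G 1 := add_right_comm _ _ _
      rw [key, e, key]
      ring
    · have key := lower G F hFK (union_comm F G ▸ subset_rfl) (fun P hP h1 h2 => hKsub P hP h2 h1)
        Q hQ P hP (h.ssubset_of_ne (Ne.symm hPQ)) hGQ hFP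
      have e : n + Finsupp.single F 1 + Finsupp.single K 1 =
        n + Finsupp.single K 1 + Finsupp.single F 1 := add_right_comm _ _ _
      have e' : n + Finsupp.single F 1 + Finsupp.single G 1 =
        n + Finsupp.single G 1 + Finsupp.single F 1 := add_right_comm _ _ _
      rw [e', key, e, key]
      ring

/-- An exponent involving the closure of a single element is not matched with any normal
exponent. -/
lemma matchCoeff_closure_singleton (hd : IsNormal M d) {i : ℕ+} (hi : i ∈ M.E)
    (n : Set ℕ+ →₀ ℕ) : matchCoeff M d (n + Finsupp.single (M.closure {i}) 1) = 0 := by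
  -- The family with this single member has relative rank at most one.
  refine if_neg fun h => ?_
  have hC := hd.rankNormal.chain
  have hne : (M.closure {i}).Nonempty := ⟨i, M.mem_closure_self i hi⟩
  obtain ⟨P, hP, hiP⟩ := exists_inStratum hC hne
    (h.covered _ (mem_support_add_single.2 (Or.inr rfl)))
  have h1 := h.dragon P hP {M.closure {i}} (by simpa using hiP)
    (by simp)
  rw [sum_add_single, if_pos (Finset.mem_singleton_self _), Finset.coe_singleton, sUnion_singleton,
    rk_congr M (M.closure_union_closure_right_eq _ _), union_singleton] at h1
  have h2 := rk_insert_le M i (chainBase d P)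
  omega

/-- A normal exponent is matched with itself. -/
lemma isMatched_self (hd : IsNormal M d) : IsMatched M d d := by
  classical
  have hC := hd.rankNormal.chain
  have huniq : ∀ P, ∀ A ∈ d.support, InStratum d P A → A = P := fun P A hA h => by
    by_contra hne
    exact h.2 (subset_chainBase hA (h.1.ssubset_of_ne hne))
  have hself : ∀ P ∈ d.support, InStratum d P P := fun P hP => by
    refine ⟨subset_rfl, fun h => ?_⟩
    rcases chainBase_eq hC P with h' | ⟨-, h'⟩
    · rw [h'] at h
      exact (hd.rankNormal.nonempty P hP).ne_empty (subset_empty_iff.1 h)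
    · exact h'.not_subset h
  refine ⟨fun A hA => ⟨A, hA, subset_rfl⟩, fun P hP => ?_, fun P hP S hS hpos => ?_⟩
  · rw [stratumMass, Finsupp.sum, Finset.sum_eq_single_of_mem P hP, if_pos (hself P hP)]
    exact fun A hA hne => if_neg fun h => hne (huniq P A hA h)
  · have hzero : ∀ A ∈ S, A ≠ P → d A = 0 := fun A hA hne => by
      by_contra h
      exact hne (huniq P A (Finsupp.mem_support_iff.2 h) (hS A hA))
    have hPS : P ∈ S := by
      by_contra hPS
      rw [Finset.sum_eq_zero fun A hA => hzero A hA fun h => hPS (h ▸ hA)] at hpos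
      exact hpos.ne rfl
    rw [Finset.sum_eq_single_of_mem P hPS hzero]
    have h1 : rk M P ≤ rk M (chainBase d P ∪ ⋃₀ ↑S) :=
      rk_mono M ((subset_sUnion_of_mem (Finset.mem_coe.2 hPS)).trans subset_union_right)
    have h2 : d P + rk M (chainBase d P) < rk M P := by
      rcases chainBase_eq hC P with h | ⟨h, h'⟩
      · rw [h, rk_empty]
        exact hd.rankNormal.lt P hP
      · exact hd.rankNormal.add_lt P hP _ h h'
    omega

/-- Triangularity: a normal exponent matched with `d` and different from it has smaller rank
weight, since its sets are moved up to the members of the support of `d`. -/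
lemma IsMatched.eq_or_rankWeight_lt (hd : IsNormal M d) (hm : IsNormal M m)
    (h : IsMatched M d m) : m = d ∨ rankWeight M m < rankWeight M d := by
  classical
  have hC := hd.rankNormal.chain
  have hex : ∀ A : Set ℕ+, ∃ P, A ∈ m.support → P ∈ d.support ∧ InStratum d P A := fun A => by
    by_cases hA : A ∈ m.support
    · obtain ⟨P, hP, hAP⟩ :=
        exists_inStratum hC (hm.rankNormal.nonempty A hA) (h.covered A hA)
      exact ⟨P, fun _ => ⟨hP, hAP⟩⟩
    · exact ⟨∅, fun h => absurd h hA⟩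
  choose π hπ using hex
  have hmap : m.mapDomain π = d := by
    ext P
    rw [Finsupp.mapDomain, Finsupp.sum_apply]
    simp only [Finsupp.single_apply]
    by_cases hP : P ∈ d.support
    · rw [← h.mass P hP, stratumMass]
      refine Finset.sum_congr rfl fun A hA => if_congr ?_ rfl rfl
      obtain ⟨h1, h2⟩ := hπ A hA
      exact ⟨fun e : π A = P => e ▸ h2, fun h' => h2.unique hC h1 hP h'⟩
    · rw [Finsupp.notMem_support_iff.1 hP]
      refine Finset.sum_eq_zero fun A hA => if_neg fun e : π A = P => hP (e ▸ (hπ A hA).1)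
  have hw : rankWeight M d = m.sum fun A k => k * rk M (π A) := by
    rw [← hmap, rankWeight, Finsupp.sum_mapDomain_index (fun _ => zero_mul _)
      fun _ _ _ => add_mul _ _ _]
  by_cases hall : ∀ A ∈ m.support, π A = A
  · left
    rw [← hmap, Finsupp.mapDomain_congr (g := id) hall, Finsupp.mapDomain_id]
  · right
    push Not at hall
    obtain ⟨A, hA, hne⟩ := hall
    rw [hw, rankWeight, Finsupp.sum, Finsupp.sum]
    refine Finset.sum_lt_sum (fun B hB => Nat.mul_le_mul_left _ (rk_mono M (hπ B hB).2.1))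
      ⟨A, hA, ?_⟩
    refine Nat.mul_lt_mul_of_pos_left ?_ (Nat.pos_of_ne_zero (Finsupp.mem_support_iff.1 hA))
    exact rk_lt_of_ssubset M (hm.isFlat A hA) (hd.isFlat _ (hπ A hA).1).subset_ground
      ((hπ A hA).2.1.ssubset_of_ne (Ne.symm hne))

end Matched

/-! ### Presentation of the Chow ring by the generators `h_F` -/

/-- Möbius inversion from above in a finite partially ordered set, without uniqueness. -/
lemma exists_sum_ge_eq {α A : Type*} [PartialOrder α] [DecidableLE α] [AddCommGroup A]
    (S : Finset α) (h : α → A) : ∃ y : α → A, ∀ F ∈ S, ∑ G ∈ S with F ≤ G, y G = h F := by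
  classical
  induction S using Finset.strongInduction with
  | H S ih =>
    rcases S.eq_empty_or_nonempty with rfl | hne
    · exact ⟨0, by simp⟩
    obtain ⟨m, hm⟩ := Finset.exists_minimal hne
    obtain ⟨y, hy⟩ := ih (S.erase m) (Finset.erase_ssubset hm.1)
    set v := h m - ∑ G ∈ S.erase m with m ≤ G, y G with hv
    refine ⟨Function.update y m v, fun F hF => ?_⟩
    have hupd : ∀ F, ∑ G ∈ S.erase m with F ≤ G, Function.update y m v G =
        ∑ G ∈ S.erase m with F ≤ G, y G := fun F => by
      refine Finset.sum_congr rfl fun G hG => Function.update_of_ne ?_ _ _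
      exact (Finset.mem_erase.1 (Finset.mem_filter.1 hG).1).1
    rw [← Finset.insert_erase hm.1, Finset.filter_insert]
    by_cases hFm : F = m
    · rw [hFm, if_pos le_rfl, Finset.sum_insert (by simp), hupd, Function.update_self, hv,
        sub_add_cancel]
    · rw [if_neg fun hle => hFm (le_antisymm hle (hm.2 hF hle)), hupd]
      exact hy F (Finset.mem_erase.2 ⟨hFm, hF⟩)

section Presentation

variable (M : FinMatroid)

/-- The ideal of relations between the generators `h_F`: those indexed by the closure of a single
element, and the quadratic relations. -/
noncomputable def nefIdeal : Ideal (MvPolynomial (Set ℕ+) ℚ) :=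
  Ideal.span ({p | ∃ i ∈ M.1.E, p = MvPolynomial.X (M.1.closure {i})} ∪
    {p | ∃ F G, IsNonemptyFlat M F ∧ IsNonemptyFlat M G ∧
      p = (MvPolynomial.X F - MvPolynomial.X (M.1.closure (F ∪ G))) *
        (MvPolynomial.X G - MvPolynomial.X (M.1.closure (F ∪ G)))})

/-- The ring presented by the generators `h_F`. -/
abbrev NefRing : Type := MvPolynomial (Set ℕ+) ℚ ⧸ nefIdeal M

/-- The generator `h_F` of the presented ring. -/
noncomputable def nefVar (F : Set ℕ+) : NefRing M := Ideal.Quotient.mk _ (MvPolynomial.X F)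

lemma nefVar_closure_singleton {i : ℕ+} (hi : i ∈ M.1.E) : nefVar M (M.1.closure {i}) = 0 :=
  Ideal.Quotient.eq_zero_iff_mem.2 (Ideal.subset_span (Or.inl ⟨i, hi, rfl⟩))

lemma nefVar_sub_mul_nefVar_sub {F G : Set ℕ+} (hF : IsNonemptyFlat M F)
    (hG : IsNonemptyFlat M G) :
    (nefVar M F - nefVar M (M.1.closure (F ∪ G))) *
      (nefVar M G - nefVar M (M.1.closure (F ∪ G))) = 0 := by
  rw [nefVar, nefVar, nefVar, ← map_sub, ← map_sub, ← map_mul]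
  exact Ideal.Quotient.eq_zero_iff_mem.2 (Ideal.subset_span (Or.inr ⟨F, G, hF, hG, rfl⟩))

/-- The finite set of nonempty flats. -/
noncomputable def nonemptyFlats : Finset (Set ℕ+) :=
  (M.2.finite_subsets.subset fun _ hF => hF.1.subset_ground :
    {F : Set ℕ+ | IsNonemptyFlat M F}.Finite).toFinset

@[simp] lemma mem_nonemptyFlats {F : Set ℕ+} : F ∈ nonemptyFlats M ↔ IsNonemptyFlat M F := by
  simp [nonemptyFlats]

open Classical in
lemma sum_properFlat {A : Type*} [AddCommMonoid A] (p : Set ℕ+ → Prop) (y : Set ℕ+ → A) :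
    ∑ F : ProperFlat M with p F.1, y F.1 =
      ∑ F ∈ (nonemptyFlats M).erase M.1.E with p F, y F := by
  refine Finset.sum_bij (fun F _ => F.1) ?_ ?_ ?_ ?_
  · intro F hF
    simp only [Finset.mem_filter, Finset.mem_erase, mem_nonemptyFlats] at hF ⊢
    exact ⟨⟨F.2.2.2, F.2.1, nonempty_iff_ne_empty.2 F.2.2.1⟩, hF.2⟩
  · intro F _ G _ h
    exact Subtype.ext h
  · intro F hF
    simp only [Finset.mem_filter, Finset.mem_erase, mem_nonemptyFlats] at hF
    exact ⟨⟨F, hF.1.2.1, hF.1.2.2.ne_empty, hF.1.1⟩, by simpa using hF.2, rfl⟩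
  · intro F _
    rfl

section Moebius

variable {M} {y : Set ℕ+ → NefRing M}

open Classical in
lemma nefVar_sub_nefVar_join
    (hy : ∀ F ∈ nonemptyFlats M, ∑ G ∈ nonemptyFlats M with F ⊆ G, y G = nefVar M F)
    {F G : Set ℕ+} (hF : IsNonemptyFlat M F) (hG : IsNonemptyFlat M G) :
    nefVar M F - nefVar M (M.1.closure (F ∪ G)) =
      ∑ H ∈ nonemptyFlats M with F ⊆ H ∧ ¬ G ⊆ H, y H := by
  have hFGE : F ∪ G ⊆ M.1.E := union_subset hF.1.subset_ground hG.1.subset_ground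
  have hsub := M.1.subset_closure _ hFGE
  rw [← hy F ((mem_nonemptyFlats M).2 hF), ← hy (M.1.closure (F ∪ G)) ((mem_nonemptyFlats M).2
    ⟨M.1.isFlat_closure _, hF.2.mono (subset_union_left.trans hsub)⟩), sub_eq_iff_eq_add,
    ← Finset.filter_filter, add_comm]
  have h : ((nonemptyFlats M).filter (M.1.closure (F ∪ G) ⊆ ·)) =
      ((nonemptyFlats M).filter (F ⊆ ·)).filter (G ⊆ ·) := by
    rw [Finset.filter_filter]
    refine Finset.filter_congr fun H hH => ?_
    rw [← union_subset_iff]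
    refine ⟨hsub.trans, fun h => ?_⟩
    rw [← ((mem_nonemptyFlats M).1 hH).1.closure]
    exact M.1.closure_subset_closure h
  rw [h, Finset.sum_filter_add_sum_filter_not]

open Classical in
/-- The Möbius inverses of the `h_F` satisfy the incomparability relations. By induction from the
top, all other terms in the expansion of the quadratic relation vanish. -/
lemma moebius_mul_eq_zero
    (hy : ∀ F ∈ nonemptyFlats M, ∑ G ∈ nonemptyFlats M with F ⊆ G, y G = nefVar M F)
    (F G : Set ℕ+) (hF : IsNonemptyFlat M F) (hG : IsNonemptyFlat M G) (hFG : ¬ F ⊆ G)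
    (hGF : ¬ G ⊆ F) : y F * y G = 0 := by
  obtain ⟨n, hn⟩ : ∃ n, 2 * rk M.1 M.1.E - (rk M.1 F + rk M.1 G) = n := ⟨_, rfl⟩
  induction n using Nat.strong_induction_on generalizing F G with
  | _ n ih =>
    have hrel := nefVar_sub_mul_nefVar_sub M hF hG
    rw [nefVar_sub_nefVar_join hy hF hG, union_comm, nefVar_sub_nefVar_join hy hG hF,
      Finset.sum_mul_sum, ← Finset.sum_product', Finset.sum_eq_single_of_mem (F, G)] at hrel
    · exact hrel
    · simp [hF, hG, hFG, hGF]
    · rintro ⟨F', G'⟩ hmem hne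
      simp only [Finset.mem_product, Finset.mem_filter, mem_nonemptyFlats] at hmem
      obtain ⟨⟨hF', hFF', hGF'⟩, hG', hGG', hFG'⟩ := hmem
      refine ih _ ?_ F' G' hF' hG' (fun h => hFG' (hFF'.trans h)) (fun h => hGF' (hGG'.trans h)) rfl
      have h1 := rk_mono M.1 hFF'
      have h2 := rk_mono M.1 hGG'
      have h3 := rk_mono M.1 hF'.1.subset_ground
      have h4 := rk_mono M.1 hG'.1.subset_ground
      by_cases hFe : F = F'
      · have hGe : G ≠ G' := fun h => hne (by rw [hFe, h])
        have := rk_lt_of_ssubset M.1 hG.1 hG'.1.subset_ground (hGG'.ssubset_of_ne hGe)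
        omega
      · have := rk_lt_of_ssubset M.1 hF.1 hF'.1.subset_ground (hFF'.ssubset_of_ne hFe)
        omega

open Classical in
lemma sum_moebius_mem
    (hy : ∀ F ∈ nonemptyFlats M, ∑ G ∈ nonemptyFlats M with F ⊆ G, y G = nefVar M F)
    {i : ℕ+} (hi : i ∈ M.1.E) : ∑ F : ProperFlat M with i ∈ F.1, y F.1 = - y M.1.E := by
  have hiE : {i} ⊆ M.1.E := singleton_subset_iff.2 hi
  have hcl : IsNonemptyFlat M (M.1.closure {i}) :=
    ⟨M.1.isFlat_closure _, ⟨i, M.1.mem_closure_self i hi⟩⟩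
  have hE : M.1.E ∈ nonemptyFlats M := (mem_nonemptyFlats M).2 ⟨M.1.ground_isFlat, ⟨i, hi⟩⟩
  have h1 := hy _ ((mem_nonemptyFlats M).2 hcl)
  have h2 : (nonemptyFlats M).filter (M.1.closure {i} ⊆ ·) = (nonemptyFlats M).filter (i ∈ ·) := by
    refine Finset.filter_congr fun F hF => ?_
    refine ⟨fun h => h (M.1.mem_closure_self i hi), fun h => ?_⟩
    rw [← ((mem_nonemptyFlats M).1 hF).1.closure]
    exact M.1.closure_subset_closure (singleton_subset_iff.2 h)
  rw [h2, nefVar_closure_singleton M hi, ← Finset.insert_erase hE, Finset.filter_insert,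
    if_pos hi, Finset.sum_insert (by simp)] at h1
  rw [sum_properFlat M (fun F => i ∈ F) y]
  exact eq_neg_of_add_eq_zero_right h1

end Moebius

/-- The homomorphism from the Chow ring to the ring presented by the generators `h_F`. -/
lemma exists_hom_nefRing :
    ∃ θ : ChowRing M →ₐ[ℚ] NefRing M, ∀ F, IsNonemptyFlat M F → θ (nef M F) = nefVar M F := by
  classical
  obtain ⟨y, hy⟩ := exists_sum_ge_eq (nonemptyFlats M) (nefVar M)
  replace hy : ∀ F ∈ nonemptyFlats M, ∑ G ∈ nonemptyFlats M with F ⊆ G, y G = nefVar M F := hy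
  let θ₀ : MvPolynomial (ProperFlat M) ℚ →ₐ[ℚ] NefRing M :=
    MvPolynomial.aeval fun F : ProperFlat M => y F.1
  have hflat : ∀ i ∈ M.1.E, θ₀ (flatSum M i) = - y M.1.E := fun i hi => by
    rw [← sum_moebius_mem hy hi, flatSum, map_sum]
    exact Finset.sum_congr rfl fun F _ => MvPolynomial.aeval_X _ _
  have hle : incomparableIdeal M ⊔ linearIdeal M ≤ RingHom.ker θ₀ := by
    refine sup_le (Ideal.span_le.2 ?_) (Ideal.span_le.2 ?_)
    · rintro _ ⟨F, G, hFG, hGF, rfl⟩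
      rw [SetLike.mem_coe, RingHom.mem_ker, map_mul, MvPolynomial.aeval_X, MvPolynomial.aeval_X]
      exact moebius_mul_eq_zero hy F.1 G.1 ⟨F.2.1, nonempty_iff_ne_empty.2 F.2.2.1⟩
        ⟨G.2.1, nonempty_iff_ne_empty.2 G.2.2.1⟩ hFG hGF
    · rintro _ ⟨i, hi, j, hj, rfl⟩
      rw [SetLike.mem_coe, RingHom.mem_ker, map_sub, hflat i hi, hflat j hj, sub_self]
  let θ : ChowRing M →ₐ[ℚ] NefRing M :=
    Ideal.Quotient.liftₐ _ θ₀ fun a ha => RingHom.mem_ker.1 (hle ha)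
  have hθX : ∀ F : ProperFlat M, θ (chowX M F) = y F.1 := fun F => by
    change θ₀ (MvPolynomial.X F) = _
    rw [MvPolynomial.aeval_X]
  refine ⟨θ, fun F hF => ?_⟩
  obtain ⟨i, hi⟩ := hF.2
  have hiE := hF.1.subset_ground hi
  have hE : M.1.E ∈ nonemptyFlats M := (mem_nonemptyFlats M).2 ⟨M.1.ground_isFlat, ⟨i, hiE⟩⟩
  rw [nef, chowAlpha_eq M hiE, map_sub, map_sum, map_sum, Finset.sum_congr rfl fun F _ => hθX F,
    Finset.sum_congr rfl fun F _ => hθX F, sum_moebius_mem hy hiE,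
    sum_properFlat M (fun G => F ⊆ G) y, ← hy F ((mem_nonemptyFlats M).2 hF),
    ← Finset.insert_erase hE, Finset.filter_insert, if_pos hF.1.subset_ground,
    Finset.sum_insert (by simp), Finset.erase_insert (Finset.notMem_erase _ _), sub_neg_eq_add,
    add_comm]

/-! ### Linear independence of the normal monomials -/

/-- The linear functional on polynomials in the `h_F` that sums the coefficients of the monomials
matched with `d`. -/
noncomputable def matchFunctional (M : Matroid ℕ+) (d : Set ℕ+ →₀ ℕ) :
    MvPolynomial (Set ℕ+) ℚ →ₗ[ℚ] ℚ :=
  (MvPolynomial.basisMonomials (Set ℕ+) ℚ).constr ℚ (matchCoeff M d)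

lemma matchFunctional_monomial (M : Matroid ℕ+) (d m : Set ℕ+ →₀ ℕ) (a : ℚ) :
    matchFunctional M d (MvPolynomial.monomial m a) = a * matchCoeff M d m := by
  have h : MvPolynomial.monomial m a = a • MvPolynomial.basisMonomials (Set ℕ+) ℚ m := by
    rw [MvPolynomial.coe_basisMonomials, MvPolynomial.smul_monomial, smul_eq_mul, mul_one]
  rw [h, map_smul, matchFunctional, Module.Basis.constr_basis, smul_eq_mul]

variable {M} in
lemma matchFunctional_eq_zero {d : Set ℕ+ →₀ ℕ} (hd : IsNormal M.1 d)
    {p : MvPolynomial (Set ℕ+) ℚ} (hp : p ∈ nefIdeal M) : matchFunctional M.1 d p = 0 := by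
  suffices h : ∀ q, matchFunctional M.1 d (q * p) = 0 by simpa using h 1
  have hmul : ∀ (u : Set ℕ+ →₀ ℕ) (a : ℚ) (A : Set ℕ+),
      MvPolynomial.monomial u a * MvPolynomial.X A =
        MvPolynomial.monomial (u + Finsupp.single A 1) a := fun u a A => by
    rw [MvPolynomial.X, MvPolynomial.monomial_mul, mul_one]
  refine Submodule.span_induction
    (p := fun p _ => ∀ q, matchFunctional M.1 d (q * p) = 0) ?_ ?_ ?_ ?_ hp
  · intro g hg q
    induction q using MvPolynomial.induction_on' with
    | add q₁ q₂ h₁ h₂ => rw [add_mul, map_add, h₁, h₂, add_zero]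
    | monomial u a =>
      rcases hg with ⟨i, hi, rfl⟩ | ⟨F, G, hF, hG, rfl⟩
      · rw [hmul, matchFunctional_monomial, matchCoeff_closure_singleton hd hi, mul_zero]
      · have h := matchCoeff_quadratic hd hF.1 hF.2 hG.1 hG.2 u
        set K := M.1.closure (F ∪ G)
        have e : MvPolynomial.monomial u a * ((MvPolynomial.X F - MvPolynomial.X K) *
              (MvPolynomial.X G - MvPolynomial.X K)) =
            MvPolynomial.monomial u a * MvPolynomial.X F * MvPolynomial.X G -
              MvPolynomial.monomial u a * MvPolynomial.X F * MvPolynomial.X K -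
              MvPolynomial.monomial u a * MvPolynomial.X G * MvPolynomial.X K +
              MvPolynomial.monomial u a * MvPolynomial.X K * MvPolynomial.X K := by ring
        rw [e]
        simp only [hmul, map_add, map_sub, matchFunctional_monomial]
        linear_combination a * h
  · intro q
    rw [mul_zero, map_zero]
  · intro p₁ p₂ _ _ h₁ h₂ q
    rw [mul_add, map_add, h₁, h₂, add_zero]
  · intro r p _ h q
    rw [smul_eq_mul, ← mul_assoc]
    exact h _

/-- The normal monomials are linearly independent: the pairing of normal exponents by being matched
is triangular for the rank weight. -/
lemma linearIndependent_nefMonomial :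
    LinearIndependent ℚ fun e : {e // IsNormal M.1 e} => nefMonomial M e.1 := by
  classical
  obtain ⟨θ, hθ⟩ := exists_hom_nefRing M
  have hθmon : ∀ e, IsNormal M.1 e →
      θ (nefMonomial M e) = Ideal.Quotient.mk (nefIdeal M) (MvPolynomial.monomial e 1) := by
    intro e he
    rw [MvPolynomial.monomial_eq, map_one, one_mul, nefMonomial, Finsupp.prod, map_prod,
      Finsupp.prod, map_prod]
    refine Finset.prod_congr rfl fun F hF => ?_
    rw [map_pow, map_pow, hθ F ⟨he.isFlat F hF, he.rankNormal.nonempty F hF⟩]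
    rfl
  rw [linearIndependent_iff']
  intro s c hc
  have hmem : ∑ e ∈ s, MvPolynomial.monomial e.1 (c e) ∈ nefIdeal M := by
    rw [← Ideal.Quotient.eq_zero_iff_mem, map_sum]
    have h := congrArg θ hc
    rw [map_sum, map_zero] at h
    rw [← h]
    refine Finset.sum_congr rfl fun e _ => ?_
    have e1 : MvPolynomial.monomial e.1 (c e) = c e • MvPolynomial.monomial e.1 (1 : ℚ) := by
      rw [MvPolynomial.smul_monomial, smul_eq_mul, mul_one]
    rw [map_smul, hθmon e.1 e.2, e1]
    rfl
  have hpair : ∀ d : {e // IsNormal M.1 e}, ∑ e ∈ s, c e * matchCoeff M.1 d.1 e.1 = 0 := by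
    intro d
    have := matchFunctional_eq_zero d.2 hmem
    rwa [map_sum, Finset.sum_congr rfl fun e _ => matchFunctional_monomial M.1 d.1 e.1 (c e)] at this
  intro d hds
  obtain ⟨n, hn⟩ : ∃ n, rankWeight M.1 d.1 = n := ⟨_, rfl⟩
  induction n using Nat.strong_induction_on generalizing d with
  | _ n ih =>
    have h := hpair d
    rw [Finset.sum_eq_single_of_mem d hds, matchCoeff, if_pos (isMatched_self d.2), mul_one] at h
    · exact h
    · intro e hes hne
      by_cases hmatch : IsMatched M.1 d.1 e.1
      · rcases hmatch.eq_or_rankWeight_lt d.2 e.2 with heq | hlt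
        · exact absurd (Subtype.ext heq) hne
        · rw [ih _ (hn ▸ hlt) e hes rfl, zero_mul]
      · rw [matchCoeff, if_neg hmatch, mul_zero]

end Presentation

/-! ### The Hilbert series -/

/-- The dimension of a graded piece is the number of normal exponents of that degree. -/
lemma finrank_chowGraded (M : FinMatroid) (hL : M.1.Loopless) (j : ℕ) :
    Module.finrank ℚ (chowGraded M j) = ((normalExponents M).filter (·.degree = j)).card := by
  classical
  let T := (normalExponents M).filter (·.degree = j)
  have hT : ∀ e : T, IsNormal M.1 e.1 := fun e =>
    mem_normalExponents.1 (Finset.mem_filter.1 e.2).1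
  have hli : LinearIndependent ℚ fun e : T => nefMonomial M e.1 :=
    (linearIndependent_nefMonomial M).comp (fun e : T => ⟨e.1, hT e⟩)
      fun a b h => Subtype.ext (congrArg (fun x => x.1) h)
  have hspan : chowGraded M j = Submodule.span ℚ (range fun e : T => nefMonomial M e.1) := by
    rw [chowGraded_eq_span M hL]
    congr 1
    ext x
    constructor
    · rintro ⟨e, ⟨he, hj⟩, rfl⟩
      exact ⟨⟨e, Finset.mem_filter.2 ⟨mem_normalExponents.2 he, hj⟩⟩, rfl⟩
    · rintro ⟨e, rfl⟩
      exact ⟨e.1, ⟨hT e, (Finset.mem_filter.1 e.2).2⟩, rfl⟩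
  rw [hspan, finrank_span_eq_card hli, Fintype.card_coe]

lemma coe_countingPolynomial (M : FinMatroid) (hL : M.1.Loopless) :
    (countingPolynomial M : PowerSeries ℤ) = hilbertSeries M := by
  ext j
  rw [Polynomial.coeff_coe, hilbertSeries, PowerSeries.coeff_mk, finrank_chowGraded M hL j,
    countingPolynomial, if_pos hL, Polynomial.finsetSum_coeff, Finset.card_filter]
  push_cast
  refine Finset.sum_congr rfl fun e _ => ?_
  rw [Polynomial.coeff_X_pow]
  simp only [eq_comm]

end ChowValuation

theorem theorem8p10 :
    ∃ f : ChowValuation.FinMatroid → Polynomial ℤ,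
      (∀ M : ChowValuation.FinMatroid, M.1.Loopless →
        (f M : PowerSeries ℤ) = ChowValuation.hilbertSeries M) ∧
      (∀ M : ChowValuation.FinMatroid, ¬ M.1.Loopless → f M = 0) ∧
      ChowValuation.IsValuativeInvariant f :=
  ⟨ChowValuation.countingPolynomial, ChowValuation.coe_countingPolynomial,
    fun _ hM => if_neg hM, ChowValuation.isInvariant_countingPolynomial,
    ChowValuation.isValuation_countingPolynomial⟩
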